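/- All graphs are finite and simple; let $G$ be a graph with vertex set $V$. **Perfect.** $G$ is *perfect* if for every induced subgraph the chromatic number equals the clique number. **$h$-perfect.** Let $\operatorname{STAB}(G)\subset\mathbb R^V$ be the convex hull of the vectors $v\in\{0,1\}^V$ with $v_iv_j=0$ whenever $i,j$ are adjacent. $G$ is *$h$-perfect* if every facet of $\operatorname{STAB}(G)$ is defined by one of the inequalities $x_i\ge 0$ with $i\in V$; $\sum_{i\in K}x_i\le 1$ with $K$ a clique of $G$; $\sum_{i\in C}x_i\le a$ with $C$ the vertex set of an odd cycle of $G$ of length $2a+1$, $a\ge 1$. **$\hbar$-perfect.** A Pauli string of length $m$ is a tensor product of $m$ matrices from $\{\mathbb 1,X,Y,Z\}$. A *realization* of $G$ is a family $S=(S_i)_{i\in V}$ of Pauli strings of one common length such that $S_i$ and $S_j$ anticommute if and only if $i$ and $j$ are adjacent; realizations always exist. For $w\in\mathbb R_{\ge 0}^V$ put $$\alpha(G,w)=\max_{I\subseteq V\text{ independent}}\ \sum_{i\in I}w_i,\qquad \beta(G,w)=\sup_{\rho}\ \sum_{i\in V}w_i\,(\operatorname{tr}\rho S_i)^2,$$ where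 $\rho$ ranges over all density matrices. Moreover, let $$\operatorname{BETA}(G)=\operatorname{conv}\Bigl\{x\in\mathbb R^V : \exists\rho\ \forall i\in V\;\; x_i\le(\operatorname{tr}\rho S_i)^2\Bigr\}\cap\mathbb R_{\ge 0}^V .$$ $G$ is *$\hbar$-perfect* if, in every realization of $G$, $\operatorname{STAB}(G)=\operatorname{BETA}(G)$ and (equivalently) $\beta(G,w)=\alpha(G,w)$ for all $w\in\mathbb R_{\ge 0}^V$. **Theorem.** Every perfect graph is $h$-perfect, and every $h$-perfect graph is $\hbar$-perfect: $$G\text{ perfect}\ \Rightarrow\ G\ h\text{-perfect}\ \Rightarrow\ G\ \hbar\text{-perfect}.$$ In addition, every odd cycle $C_{2a+1}$, $a\ge 1$, is $h$-perfect. -/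

import Mathlib

namespace HbarGraph

open scoped ComplexOrder

/-! ### Pauli strings, states and the beta body -/

/-- The labels of the four one-qubit Pauli matrices (`one` stands for the identity). -/
inductive PauliLabel : Type
  | one
  | X
  | Y
  | Z

/-- The one-qubit Pauli matrices. -/
def pauliMatrix : PauliLabel → Matrix (Fin 2) (Fin 2) ℂ
  | .one => !![1, 0; 0, 1]
  | .X => !![0, 1; 1, 0]
  | .Y => !![0, -Complex.I; Complex.I, 0]
  | .Z => !![1, 0; 0, -1]

/-- The Pauli string with letters `p 0, …, p (m - 1)`: the tensor product of the corresponding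
Pauli matrices, an operator on `m` qubits whose standard basis is indexed by `Fin m → Fin 2`. -/
def pauliString {m : ℕ} (p : Fin m → PauliLabel) : Matrix (Fin m → Fin 2) (Fin m → Fin 2) ℂ :=
  Matrix.of fun x y => ∏ k, pauliMatrix (p k) (x k) (y k)

/-- Density matrices. -/
def IsState {ι : Type*} [Fintype ι] (ρ : Matrix ι ι ℂ) : Prop :=
  ρ.PosSemidef ∧ ρ.trace = 1

/-- The expectation value `⟨A⟩_ρ` (it is real if `A` is Hermitian and `ρ` is a state). -/
noncomputable def expectation {ι : Type*} [Fintype ι] (A ρ : Matrix ι ι ℂ) : ℝ :=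
  (ρ * A).trace.re

section

variable {V : Type*}

/-- `G` is the frustration graph of the family `S` of Pauli strings: two vertices are adjacent
if and only if their strings anticommute. -/
def IsRealization (G : SimpleGraph V) {m : ℕ} (S : V → Fin m → PauliLabel) : Prop :=
  ∀ i j, G.Adj i j ↔
    pauliString (S i) * pauliString (S j) = -(pauliString (S j) * pauliString (S i))

/-- The weighted beta number, computed in the realization `S`. -/
noncomputable def betaNumber [Fintype V] {m : ℕ} (S : V → Fin m → PauliLabel) (w : V → ℝ) : ℝ :=
  sSup {r | ∃ ρ, IsState ρ ∧ r = ∑ i, w i * expectation (pauliString (S i)) ρ ^ 2}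

/-- The simultaneous variance range `𝒬(S)`. -/
def varianceRange {m : ℕ} (S : V → Fin m → PauliLabel) : Set (V → ℝ) :=
  {v | ∃ ρ, IsState ρ ∧ v = fun i => expectation (pauliString (S i)) ρ ^ 2}

/-- The beta body: the convex hull of the down-closure of the simultaneous variance range,
intersected with the nonnegative orthant. -/
def betaBody {m : ℕ} (S : V → Fin m → PauliLabel) : Set (V → ℝ) :=
  convexHull ℝ (lowerClosure (varianceRange S) : Set (V → ℝ)) ∩ {v | ∀ i, 0 ≤ v i}

/-! ### Independent sets and the stable set polytope -/

/-- The weighted independence number (a maximum over the finitely many independent sets). -/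
noncomputable def indepNumber (G : SimpleGraph V) (w : V → ℝ) : ℝ :=
  sSup {r | ∃ s : Finset V, G.IsIndepSet (s : Set V) ∧ r = ∑ i ∈ s, w i}

/-- The stable set polytope `STAB(G)`. -/
def stab (G : SimpleGraph V) : Set (V → ℝ) :=
  convexHull ℝ {v | (∀ i j, G.Adj i j → v i * v j = 0) ∧ ∀ i, v i = 0 ∨ v i = 1}

/-! ### Three notions of perfection -/

/-- A graph is perfect if the chromatic number and the clique number agree for all induced
subgraphs. -/
def IsPerfect (G : SimpleGraph V) : Prop :=
  ∀ s : Set V, (G.induce s).chromaticNumber = ((G.induce s).cliqueNum : ℕ∞)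

/-- `F` is a facet of the polytope `P`: a nonempty (exposed) face of dimension `dim P - 1`. -/
def IsFacet (P F : Set (V → ℝ)) : Prop :=
  IsExposed ℝ P F ∧ F.Nonempty ∧
    Module.finrank ℝ (vectorSpan ℝ F) + 1 = Module.finrank ℝ (vectorSpan ℝ P)

/-- `C` is the vertex set of a (not necessarily chordless) cycle of length `2a+1 ≥ 3` in `G`. -/
def IsOddCycle (G : SimpleGraph V) (a : ℕ) (C : Finset V) : Prop :=
  1 ≤ a ∧ ∃ f : (SimpleGraph.cycleGraph (2 * a + 1)).Copy G, Set.range f = (C : Set V)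

/-- A graph is `h`-perfect if every facet of `STAB(G)` is given by one of the inequalities
`x_i ≥ 0`, `∑_{i ∈ K} x_i ≤ 1` for a clique `K`, or `∑_{i ∈ C} x_i ≤ a` for an odd cycle `C`
with `2a+1` vertices. -/
def IsHPerfect (G : SimpleGraph V) : Prop :=
  ∀ F, IsFacet (stab G) F →
    (∃ i, F = {x ∈ stab G | x i = 0}) ∨
    (∃ K : Finset V, G.IsClique (K : Set V) ∧ F = {x ∈ stab G | ∑ i ∈ K, x i = 1}) ∨
    (∃ (a : ℕ) (C : Finset V), IsOddCycle G a C ∧ F = {x ∈ stab G | ∑ i ∈ C, x i = a})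

/-- A graph is `ħ`-perfect if `STAB(G) = BETA(G)` and, equivalently, `β(G,w) = α(G,w)` for all
`w ≥ 0`. Both forms are required, in every realization of `G` by Pauli strings; a realization
of a finite graph always exists, see `exists_isRealization`. -/
def IsHbarPerfect [Fintype V] (G : SimpleGraph V) : Prop :=
  ∀ (m : ℕ) (S : V → Fin m → PauliLabel), IsRealization G S →
    stab G = betaBody S ∧ ∀ w : V → ℝ, (∀ i, 0 ≤ w i) → betaNumber S w = indepNumber G w

end

/-! ### Every finite graph is a frustration graph -/

theorem pauliString_mul_apply {m : ℕ} (p q : Fin m → PauliLabel) (x y : Fin m → Fin 2) :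
    (pauliString p * pauliString q) x y =
      ∏ k, (pauliMatrix (p k) * pauliMatrix (q k)) (x k) (y k) := by
  simp only [pauliString, Matrix.mul_apply, Matrix.of_apply, ← Finset.prod_mul_distrib]
  rw [Finset.prod_univ_sum]
  simp

theorem pauliMatrix_mul_self (p : PauliLabel) : pauliMatrix p * pauliMatrix p = 1 := by
  cases p <;> ext i j <;> fin_cases i <;> fin_cases j <;> simp [pauliMatrix]

theorem pauliString_mul_self {m : ℕ} (p : Fin m → PauliLabel) :
    pauliString p * pauliString p = 1 := by
  ext x y
  rw [pauliString_mul_apply]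
  simp only [pauliMatrix_mul_self, Matrix.one_apply, funext_iff]
  by_cases h : ∀ k, x k = y k
  · simp [h]
  · obtain ⟨k, hk⟩ := not_forall.1 h
    rw [if_neg h]
    exact Finset.prod_eq_zero (Finset.mem_univ k) (by simp [hk])

theorem exists_isRealization {V : Type*} [Fintype V] (G : SimpleGraph V) :
    ∃ (m : ℕ) (S : V → Fin m → PauliLabel), IsRealization G S := by
  classical
  let e := Fintype.equivFin V
  let S : V → Fin (Fintype.card V) → PauliLabel := fun i k =>
    if k = e i then .X else if k < e i ∧ G.Adj (e.symm k) i then .Z else .one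
  have key : ∀ i j, e j < e i → pauliString (S i) * pauliString (S j) =
      (if G.Adj i j then (-1 : ℂ) else 1) • (pauliString (S j) * pauliString (S i)) := by
    intro i j hij
    have hk : ∀ k, pauliMatrix (S i k) * pauliMatrix (S j k) =
        (if k = e j then (if G.Adj i j then (-1 : ℂ) else 1) else 1) •
          (pauliMatrix (S j k) * pauliMatrix (S i k)) := by
      intro k
      by_cases hkj : k = e j
      · subst hkj
        by_cases ha : G.Adj i j
        · have hb := ha.symm
          simp only [S, hij.ne, hij, ha, hb, Equiv.symm_apply_apply, if_true, if_false, and_self]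
          ext a b
          fin_cases a <;> fin_cases b <;> simp [pauliMatrix]
        · have hb : ¬ G.Adj j i := fun h => ha h.symm
          simp only [S, hij.ne, ha, hb, Equiv.symm_apply_apply, if_true, if_false, and_false]
          ext a b
          fin_cases a <;> fin_cases b <;> simp [pauliMatrix]
      · simp only [hkj, if_false, one_smul]
        by_cases hki : k = e i
        · subst hki
          simp only [S, hkj, hij.not_gt, if_true, if_false, false_and]
          ext a b
          fin_cases a <;> fin_cases b <;> simp [pauliMatrix]
        · simp only [S, hki, hkj, if_false]
          split_ifs <;> ext a b <;> fin_cases a <;> fin_cases b <;> simp [pauliMatrix]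
    ext x y
    rw [Matrix.smul_apply, pauliString_mul_apply, pauliString_mul_apply]
    simp only [hk, Matrix.smul_apply, smul_eq_mul, Finset.prod_mul_distrib]
    congr 1
    simp
  have ne : ∀ i j, pauliString (S i) * pauliString (S j) ≠
      -(pauliString (S i) * pauliString (S j)) := by
    intro i j h
    have h0 : pauliString (S i) * pauliString (S j) = 0 := by
      ext x y
      have hxy := congrFun (congrFun h x) y
      rw [Matrix.neg_apply] at hxy
      exact self_eq_neg.1 hxy
    have h1 : pauliString (S i) * (pauliString (S i) * pauliString (S j)) * pauliString (S j)
        = 1 := by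
      rw [← mul_assoc, pauliString_mul_self, one_mul, pauliString_mul_self]
    rw [h0] at h1
    simp at h1
  refine ⟨_, S, fun i j => ?_⟩
  rcases lt_trichotomy (e j) (e i) with h | h | h
  · have := key i j h
    by_cases ha : G.Adj i j
    · simp only [ha, if_true] at this
      simp [ha, this]
    · simp only [ha, if_false, one_smul] at this
      simp only [ha, false_iff, this]
      exact ne j i
  · have : j = i := e.injective h
    subst this
    simpa using ne j j
  · have := key j i h
    by_cases ha : G.Adj i j
    · have hb := ha.symm
      simp only [hb, if_true] at this
      simp [ha, this]
    · have hb : ¬ G.Adj j i := fun h => ha h.symm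
      simp only [hb, if_false, one_smul] at this
      simp only [ha, false_iff, this]
      exact ne i j

end HbarGraph

/-! Everything passes through descriptions of STAB(G) by inequalities. STAB(G) is full-dimensional,
so a facet inequality is unique up to a positive factor (`IsFacet.exists_smul_eq`). Hence a finite
system describing STAB(G) contains an inequality for each facet
(`IsFacet.exists_eq_of_description`). Conversely, a point outside violates some facet
(`exists_isFacet_of_notMem_convexHull`), so `h`-perfection makes the listed inequalities a
description (`IsHPerfect.mem_stab`).

For perfect graphs and odd cycles, a solution `x` of the inequalities is the limit of `⌊N x⌋ / N`,
and `⌊N x⌋` is a sum of `N` independent sets: by a replication argument for perfect graphs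
(`IsPerfect.exists_decomposition`), by placing arcs on the circle ℤ/N for odd cycles
(`cycleGraph_exists_decomposition`).

STAB(G) ⊆ BETA(G) because commuting Pauli strings have a joint eigenvector. For the converse,
squared expectations must obey the clique and odd cycle inequalities. The clique case is
nonnegativity of a variance (`sum_sq_expectation_le_one`). For odd cycles, chords are first removed
combinatorially (`sum_oddClosedWalk_le`). On a chordless cycle, the Gram matrix of the partial
products along a path is `r + K` with `K` Hermitian and antisymmetric of odd order `2a+1`. One
eigenvalue of `K` is zero and the others lie in `[-r, r]`, so its squared Frobenius norm is at most
`2a r²`, of which the cycle entries take at most half (`sum_path_normSq_le`). The operator closing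
the cycle is, up to sign, the product of the others on each eigenspace of the central product of all
of them; the two eigenspaces are recombined by a Minkowski estimate (`sum_cycle_normSq_le`). -/

namespace HbarGraph

open scoped ComplexOrder Matrix

/-! ### Facets of full-dimensional polytopes -/

section Facets

variable {V : Type*} [Fintype V]

/-- Two inequalities valid on a full-dimensional set which are both tight on the same facet are
proportional. -/
theorem IsFacet.exists_smul_eq {P F : Set (V → ℝ)} (hF : IsFacet P F)
    (hP : vectorSpan ℝ P = ⊤) {l a : (V → ℝ) →ₗ[ℝ] ℝ} {b c : ℝ} (hl : ∀ y ∈ P, l y ≤ c)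
    (hFl : F = {y ∈ P | l y = c}) (ha : a ≠ 0) (hab : ∀ y ∈ P, a y ≤ b)
    (hFa : ∀ y ∈ F, a y = b) : ∃ t : ℝ, 0 < t ∧ a = t • l ∧ b = t * c := by
  obtain ⟨-, ⟨y₀, hy₀⟩, hdim⟩ := hF
  have hy₀' : y₀ ∈ P ∧ l y₀ = c := by rw [hFl] at hy₀; exact hy₀
  have hFP : F ≠ P := by
    rintro rfl
    omega
  have hl0 : l ≠ 0 := by
    rintro rfl
    apply hFP
    rw [hFl]
    ext y
    simpa using fun _ => hy₀'.2
  -- The direction space of `F` lies in the kernel, and both have codimension one.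
  have hker : ∀ (f : (V → ℝ) →ₗ[ℝ] ℝ) (d : ℝ), f ≠ 0 → (∀ y ∈ F, f y = d) →
      vectorSpan ℝ F = LinearMap.ker f := by
    intro f d hf hd
    apply Submodule.eq_of_le_of_finrank_eq
    · rw [vectorSpan_def, Submodule.span_le]
      rintro _ ⟨x, hx, y, hy, rfl⟩
      simp [hd x hx, hd y hy]
    · have h := Module.Dual.finrank_ker_add_one_of_ne_zero (f := f) hf
      rw [hP, finrank_top] at hdim
      omega
  have hkl := hker l c hl0 (fun y hy => by rw [hFl] at hy; exact hy.2)
  have hka := hker a b ha hFa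
  obtain ⟨t, rfl⟩ : ∃ t : ℝ, t • l = a := by
    obtain ⟨u, hu⟩ : ∃ u, l u ≠ 0 := by
      by_contra! h
      exact hl0 (LinearMap.ext h)
    refine ⟨a u / l u, LinearMap.ext fun x => ?_⟩
    have hx : x - (l x / l u) • u ∈ LinearMap.ker a := by
      rw [← hka, hkl, LinearMap.mem_ker]
      simp [hu]
    rw [LinearMap.mem_ker] at hx
    simp only [map_sub, map_smul, smul_eq_mul, LinearMap.smul_apply] at hx ⊢
    field_simp at hx ⊢
    linarith
  have hb : b = t * c := by
    rw [← hFa y₀ hy₀, LinearMap.smul_apply, hy₀'.2, smul_eq_mul]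
  refine ⟨t, ?_, rfl, hb⟩
  -- A point of `P` off the facet fixes the sign of `t`.
  obtain ⟨z, hz, hzc⟩ : ∃ z ∈ P, l z < c := by
    by_contra! h
    apply hFP
    rw [hFl]
    ext y
    exact ⟨fun h => h.1, fun hy => ⟨hy, le_antisymm (hl y hy) (h y hy)⟩⟩
  have h1 := hab z hz
  have ht : t ≠ 0 := by
    rintro rfl
    simp at ha
  rw [hb, LinearMap.smul_apply, smul_eq_mul] at h1
  by_contra! h
  have : t < 0 := lt_of_le_of_ne h ht
  nlinarith

/-- If a full-dimensional polytope is described by finitely many inequalities, then each of its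
facets is given by one of them. -/
theorem IsFacet.exists_eq_of_description {ι : Type*} [Finite ι] {P F : Set (V → ℝ)}
    (hF : IsFacet P F) (hP : vectorSpan ℝ P = ⊤) (A : ι → (V → ℝ) →L[ℝ] ℝ) (b : ι → ℝ)
    (hA : ∀ i, A i ≠ 0) (hdesc : ∀ x, x ∈ P ↔ ∀ i, A i x ≤ b i) :
    ∃ i, F = {x ∈ P | A i x = b i} := by
  classical
  cases nonempty_fintype ι
  have hPconv : Convex ℝ P := by
    have : P = ⋂ i, {x | A i x ≤ b i} := by
      ext x
      simp [hdesc]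
    rw [this]
    exact convex_iInter fun i => convex_halfSpace_le (A i).toLinearMap.isLinear _
  have hFconv : Convex ℝ F := hF.1.convex hPconv
  obtain ⟨l, hl⟩ := hF.1 hF.2.1
  obtain ⟨y₀, hy₀⟩ := hF.2.1
  have hFP : F ⊆ P := hF.1.subset
  have hy₀' := hy₀
  rw [hl] at hy₀'
  have hlc : ∀ y ∈ P, l y ≤ l y₀ := hy₀'.2
  have hFl : F = {y ∈ P | l y = l y₀} := by
    rw [hl]
    ext y
    constructor
    · exact fun h => ⟨h.1, le_antisymm (hlc y h.1) (h.2 y₀ hy₀'.1)⟩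
    · exact fun h => ⟨h.1, fun z hz => h.2 ▸ hlc z hz⟩
  -- Otherwise each inequality is strict somewhere on `F`. Averaging gives one point of `F` where
  -- all are strict; it is interior to `P` and maximizes `l`, so `l = 0` and `F = P`, against the
  -- dimension count.
  obtain ⟨i, hi⟩ : ∃ i, ∀ y ∈ F, A i y = b i := by
    by_contra! hcon
    have hstrict : ∀ i, ∃ y ∈ F, A i y < b i := fun i => by
      obtain ⟨y, hy, hne⟩ := hcon i
      exact ⟨y, hy, lt_of_le_of_ne ((hdesc y).1 (hFP hy) i) hne⟩
    have hall : ∀ s : Finset ι, ∃ y ∈ F, ∀ i ∈ s, A i y < b i := by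
      intro s
      induction s using Finset.induction_on with
      | empty => exact ⟨y₀, hy₀, by simp⟩
      | insert i s _ ih =>
        obtain ⟨y, hy, hys⟩ := ih
        obtain ⟨z, hz, hzi⟩ := hstrict i
        refine ⟨(1 / 2 : ℝ) • y + (1 / 2 : ℝ) • z,
          hFconv hy hz (by norm_num) (by norm_num) (by norm_num), ?_⟩
        intro j hj
        have hyj := (hdesc y).1 (hFP hy) j
        have hzj := (hdesc z).1 (hFP hz) j
        simp only [map_add, map_smul, smul_eq_mul]
        rcases Finset.mem_insert.1 hj with rfl | hj
        · linarith
        · linarith [hys j hj]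
    obtain ⟨y, hy, hyA⟩ := hall Finset.univ
    have hnhds : P ∈ nhds y := by
      have h : ∀ᶠ z in nhds y, ∀ i, A i z < b i :=
        Filter.eventually_all.2 fun i =>
          (A i).continuous.continuousAt.eventually_lt continuousAt_const
            (hyA i (Finset.mem_univ i))
      filter_upwards [h] with z hz
      exact (hdesc z).2 fun i => (hz i).le
    have hmax : IsLocalMax l y := by
      filter_upwards [hnhds] with z hz
      rw [hl] at hy
      exact hy.2 z hz
    have hl0 := hmax.fderiv_eq_zero
    rw [ContinuousLinearMap.fderiv] at hl0
    have : F = P := by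
      rw [hFl, hl0]
      ext
      simp
    have hdim := hF.2.2
    rw [this] at hdim
    omega
  refine ⟨i, ?_⟩
  obtain ⟨t, ht, hta, htb⟩ := hF.exists_smul_eq hP (l := l.toLinearMap)
    (a := (A i).toLinearMap) (b := b i) (c := l y₀) hlc hFl
    (fun h => hA i (ContinuousLinearMap.coe_injective h))
    (fun y hy => (hdesc y).1 hy i) hi
  rw [hFl]
  ext y
  have h1 : A i y = t * l y := LinearMap.congr_fun hta y
  simp only [Set.mem_ofPred_eq, h1, htb, mul_right_inj' ht.ne']

/-- A point outside a full-dimensional polytope violates an inequality defining a facet. -/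
theorem exists_isFacet_of_notMem_convexHull {W : Set (V → ℝ)} (hW : W.Finite)
    (hspan : affineSpan ℝ (convexHull ℝ W) = ⊤) {x : V → ℝ} (hx : x ∉ convexHull ℝ W) :
    ∃ (l : (V → ℝ) →L[ℝ] ℝ) (c : ℝ), (∀ y ∈ convexHull ℝ W, l y ≤ c) ∧ c < l x ∧
      IsFacet (convexHull ℝ W) {y ∈ convexHull ℝ W | l y = c} := by
  classical
  set P := convexHull ℝ W with hPdef
  have hPconv : Convex ℝ P := convex_convexHull ℝ W
  have hPclosed : IsClosed P := (hW.isCompact_convexHull ℝ).isClosed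
  obtain ⟨p, hp⟩ := hPconv.interior_nonempty_iff_affineSpan_eq_top.2 hspan
  obtain ⟨δ, hδ, hball⟩ := Metric.nhds_basis_closedBall.mem_iff.1 (mem_interior_iff_mem_nhds.1 hp)
  have hpP : p ∈ P := interior_subset hp
  -- The polar body of `P` about the interior point `p`. It is compact, and its extreme points
  -- correspond to facets of `P`.
  set D : Set ((V → ℝ) →L[ℝ] ℝ) := {l | ∀ v ∈ W, l (v - p) ≤ 1} with hD
  have hDP : ∀ l ∈ D, ∀ y ∈ P, l (y - p) ≤ 1 := by
    intro l hl y hy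
    have hsub : P ⊆ {y | l y ≤ 1 + l p} := by
      apply convexHull_min
      · intro v hv
        have := hl v hv
        rw [map_sub] at this
        simp only [Set.mem_ofPred_eq]
        linarith
      · exact convex_halfSpace_le l.toLinearMap.isLinear _
    have := hsub hy
    simp only [Set.mem_ofPred_eq] at this
    rw [map_sub]
    linarith
  have hDclosed : IsClosed D := by
    have : D = ⋂ v ∈ W, {l | l (v - p) ≤ 1} := by
      ext l
      simp [hD]
    rw [this]
    refine isClosed_biInter fun v _ => isClosed_le ?_ continuous_const
    exact (ContinuousLinearMap.apply ℝ ℝ (v - p)).continuous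
  have hDbdd : Bornology.IsBounded D := by
    refine (Metric.isBounded_closedBall (x := (0 : (V → ℝ) →L[ℝ] ℝ)) (r := 1 / δ)).subset ?_
    intro l hl
    rw [mem_closedBall_zero_iff]
    refine l.opNorm_le_bound (by positivity) fun z => ?_
    refine LinearMap.bound_of_ball_bound' hδ 1 l.toLinearMap (fun z hz => ?_) z
    rw [mem_closedBall_zero_iff] at hz
    have h1 := hDP l hl (p + z) (hball (by simpa using hz))
    have h2 := hDP l hl (p - z) (hball (by simpa using hz))
    simp only [add_sub_cancel_left, sub_sub_cancel_left, map_neg] at h1 h2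
    rw [Real.norm_eq_abs, ContinuousLinearMap.coe_coe]
    exact abs_le.2 ⟨by linarith, h1⟩
  have hDcompact : IsCompact D := Metric.isCompact_of_isClosed_isBounded hDclosed hDbdd
  obtain ⟨w, hwD, hwx⟩ : ∃ w ∈ D, 1 < w (x - p) := by
    obtain ⟨f, u, hfu, hux⟩ := geometric_hahn_banach_closed_point hPconv hPclosed hx
    have ht : 0 < u - f p := by linarith [hfu p hpP]
    refine ⟨(u - f p)⁻¹ • f, fun v hv => ?_, ?_⟩
    · have := hfu v (subset_convexHull ℝ W hv)
      rw [smul_apply, smul_eq_mul, map_sub, inv_mul_le_iff₀ ht]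
      linarith
    · rw [smul_apply, smul_eq_mul, map_sub, lt_inv_mul_iff₀ ht]
      linarith
  -- The functionals in `D` that separate `x` best form an exposed face of `D`; an extreme point of
  -- that face is extreme in `D`.
  set ev := ContinuousLinearMap.apply ℝ ℝ (x - p)
  have hexp : IsExposed ℝ D (ev.toExposed D) := ContinuousLinearMap.toExposed.isExposed
  have hne : (ev.toExposed D).Nonempty := by
    obtain ⟨m, hm, hmax⟩ := hDcompact.exists_isMaxOn ⟨w, hwD⟩ ev.continuous.continuousOn
    exact ⟨m, hm, hmax⟩
  obtain ⟨l, hl⟩ := (hexp.isCompact hDcompact).extremePoints_nonempty hne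
  have hlx : 1 < l (x - p) := hwx.trans_le (hl.1.2 w hwD)
  have hlext : l ∈ D.extremePoints ℝ := hexp.isExtreme.extremePoints_subset_extremePoints hl
  have hlD : l ∈ D := hlext.1
  set T : Set (V → ℝ) := {u | ∃ v ∈ W, l (v - p) = 1 ∧ u = v - p}
  -- If the tight vertices did not span, some `d ≠ 0` would vanish on all of them. For small `ε`
  -- both `l ± (ε / 2) • d` would stay in `D`, as `W` is finite, contradicting extremality.
  have hT : Submodule.span ℝ T = ⊤ := by
    by_contra hTne
    obtain ⟨d₀, hd₀, hdT⟩ := Submodule.exists_le_ker_of_lt_top _ (lt_top_iff_ne_top.2 hTne)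
    set d : (V → ℝ) →L[ℝ] ℝ := LinearMap.toContinuousLinearMap d₀
    have hd : d ≠ 0 := fun h => hd₀ (by
      have := congrArg ContinuousLinearMap.toLinearMap h
      simpa [d] using this)
    have hpert : ∀ v ∈ W, ∀ᶠ ε : ℝ in nhds 0, (l + ε • d) (v - p) ≤ 1 := by
      intro v hv
      rcases (hlD v hv).lt_or_eq with h | h
      · have hc : ContinuousAt (fun ε : ℝ => (l + ε • d) (v - p)) 0 := by
          simp only [add_apply, smul_apply]
          fun_prop
        exact (hc.eventually_lt continuousAt_const (by simpa using h)).mono fun _ h => h.le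
      · have : d (v - p) = 0 := hdT (Submodule.subset_span ⟨v, hv, h, rfl⟩)
        simp [this, h]
    have hpert' : ∀ᶠ ε : ℝ in nhds 0, l + ε • d ∈ D :=
      (Filter.eventually_all_finite hW).2 hpert
    obtain ⟨ε, hε, hεD⟩ := Metric.eventually_nhds_iff.1 hpert'
    have hp1 : l + (ε / 2) • d ∈ D := hεD (by
      rw [Real.dist_eq, sub_zero, abs_of_pos (by positivity)]; linarith)
    have hm1 : l + (-(ε / 2)) • d ∈ D := hεD (by
      rw [Real.dist_eq, sub_zero, abs_neg, abs_of_pos (by positivity)]; linarith)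
    have hseg : l ∈ openSegment ℝ (l + (ε / 2) • d) (l + (-(ε / 2)) • d) :=
      ⟨1 / 2, 1 / 2, by norm_num, by norm_num, by norm_num, by module⟩
    have := hlext.2 hp1 hm1 hseg
    have h0 : (ε / 2) • d = 0 := by simpa using this
    exact (smul_ne_zero (by positivity) hd) h0
  obtain ⟨v₀, hv₀, hv₀l⟩ : ∃ v ∈ W, l (v - p) = 1 := by
    by_contra! h
    have hTe : T = ∅ := by
      ext u
      simp only [T, Set.mem_ofPred_eq, Set.mem_empty_iff_false, iff_false]
      rintro ⟨v, hv, h1, -⟩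
      exact h v hv h1
    rw [hTe, Submodule.span_empty] at hT
    have h0 : x - p ∈ (⊥ : Submodule ℝ (V → ℝ)) := hT ▸ Submodule.mem_top
    rw [Submodule.mem_bot] at h0
    rw [h0, map_zero] at hlx
    linarith
  have hle : ∀ y ∈ P, l y ≤ 1 + l p := fun y hy => by
    have := hDP l hlD y hy
    rw [map_sub] at this
    linarith
  set F := {y ∈ P | l y = 1 + l p} with hF
  have hv₀F : v₀ ∈ F := ⟨subset_convexHull ℝ W hv₀, by rw [map_sub] at hv₀l; linarith⟩
  refine ⟨l, 1 + l p, hle, by rw [map_sub] at hlx; linarith, ?_, ⟨v₀, hv₀F⟩, ?_⟩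
  · intro _
    refine ⟨l, ?_⟩
    ext y
    constructor
    · exact fun h => ⟨h.1, fun z hz => h.2 ▸ hle z hz⟩
    · exact fun h => ⟨h.1, le_antisymm (hle y h.1) (hv₀F.2 ▸ h.2 v₀ hv₀F.1)⟩
  · have hPtop : vectorSpan ℝ P = ⊤ := by
      rw [← direction_affineSpan, hspan, AffineSubspace.direction_top]
    rw [hPtop, finrank_top]
    apply le_antisymm
    · have hl0 : l.toLinearMap ≠ 0 := by
        intro h
        have : l (x - p) = 0 := LinearMap.congr_fun h (x - p)
        linarith
      rw [← Module.Dual.finrank_ker_add_one_of_ne_zero (f := l.toLinearMap) hl0]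
      gcongr
      apply Submodule.finrank_mono
      rw [vectorSpan_def, Submodule.span_le]
      rintro _ ⟨y, hy, z, hz, rfl⟩
      simp [hy.2, hz.2]
    -- The tight vectors `v - p` differ from `v₀ - p` by directions of `F`, so `F` misses at most
    -- one dimension.
    · have hsup : vectorSpan ℝ F ⊔ Submodule.span ℝ {v₀ - p} = ⊤ := by
        rw [eq_top_iff, ← hT, Submodule.span_le]
        rintro _ ⟨v, hv, hvl, rfl⟩
        have hvF : v ∈ F := ⟨subset_convexHull ℝ W hv, by rw [map_sub] at hvl; linarith⟩
        have : v - p = (v - v₀) + (v₀ - p) := by abel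
        rw [this]
        exact Submodule.add_mem_sup (vsub_mem_vectorSpan ℝ hvF hv₀F)
          (Submodule.mem_span_singleton_self _)
      calc Module.finrank ℝ (V → ℝ)
          = Module.finrank ℝ (vectorSpan ℝ F ⊔ Submodule.span ℝ {v₀ - p} :
              Submodule ℝ (V → ℝ)) := by rw [hsup, finrank_top]
        _ ≤ _ := Submodule.finrank_add_le_finrank_add_finrank _ _
        _ ≤ _ := by
          gcongr
          simpa using finrank_span_le_card (R := ℝ) ({v₀ - p} : Set (V → ℝ))

end Facets

/-! ### The stable set polytope -/

section Stab

variable {V : Type*}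

theorem finite_stab_vertices [Finite V] (G : SimpleGraph V) :
    {v : V → ℝ | (∀ i j, G.Adj i j → v i * v j = 0) ∧ ∀ i, v i = 0 ∨ v i = 1}.Finite := by
  refine (Set.Finite.pi' (t := fun _ : V => ({0, 1} : Set ℝ)) fun _ => Set.toFinite _).subset ?_
  intro v hv i
  simpa using hv.2 i

theorem isClosed_stab [Finite V] (G : SimpleGraph V) : IsClosed (stab G) :=
  ((finite_stab_vertices G).isCompact_convexHull ℝ).isClosed

open Classical in
theorem indicator_mem_stab {G : SimpleGraph V} {s : Finset V} (hs : G.IsIndepSet (s : Set V)) :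
    (fun i => if i ∈ s then (1 : ℝ) else 0) ∈ stab G := by
  refine subset_convexHull ℝ _ ⟨fun i j hij => ?_, fun i => ?_⟩
  · by_cases hi : i ∈ s
    · by_cases hj : j ∈ s
      · exact absurd hij (hs hi hj hij.ne)
      · simp [hj]
    · simp [hi]
  · by_cases hi : i ∈ s <;> simp [hi]

theorem zero_mem_stab (G : SimpleGraph V) : (0 : V → ℝ) ∈ stab G :=
  subset_convexHull ℝ _ ⟨by simp, by simp⟩

theorem vectorSpan_stab [Fintype V] (G : SimpleGraph V) : vectorSpan ℝ (stab G) = ⊤ := by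
  classical
  rw [eq_top_iff, ← (Pi.basisFun ℝ V).span_eq, Submodule.span_le]
  rintro _ ⟨i, rfl⟩
  have h1 : Pi.single i (1 : ℝ) ∈ stab G := by
    have := indicator_mem_stab (G := G) (s := {i}) (by simp)
    convert this using 1
    ext j
    simp [Pi.single_apply]
  simpa using vsub_mem_vectorSpan ℝ h1 (zero_mem_stab G)

theorem affineSpan_stab [Fintype V] (G : SimpleGraph V) : affineSpan ℝ (stab G) = ⊤ :=
  (AffineSubspace.affineSpan_eq_top_iff_vectorSpan_eq_top_of_nonempty ℝ _ _
    ⟨0, zero_mem_stab G⟩).2 (vectorSpan_stab G)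

/-- A linear inequality holds on the stable set polytope if it holds for all independent sets. -/
theorem le_of_mem_stab {G : SimpleGraph V} (l : (V → ℝ) →ₗ[ℝ] ℝ) {c : ℝ}
    (h : ∀ v : V → ℝ, (∀ i j, G.Adj i j → v i * v j = 0) → (∀ i, v i = 0 ∨ v i = 1) → l v ≤ c)
    {x : V → ℝ} (hx : x ∈ stab G) : l x ≤ c := by
  have : stab G ⊆ {x | l x ≤ c} :=
    convexHull_min (fun v hv => h v hv.1 hv.2) (convex_halfSpace_le l.isLinear _)
  exact this hx

/-- The sum of the coordinates in `s`, as a linear functional. -/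
noncomputable def coordSum (s : Finset V) : (V → ℝ) →L[ℝ] ℝ :=
  ∑ i ∈ s, ContinuousLinearMap.proj i

@[simp]
theorem coordSum_apply (s : Finset V) (x : V → ℝ) : coordSum s x = ∑ i ∈ s, x i := by
  simp [coordSum]

theorem coordSum_ne_zero {s : Finset V} (hs : s.Nonempty) : coordSum s ≠ 0 := by
  intro h
  have := congrArg (fun l => l (fun _ => 1)) h
  simp at this
  simp [this] at hs

theorem nonneg_of_mem_stab {G : SimpleGraph V} {x : V → ℝ} (hx : x ∈ stab G) (i : V) :
    0 ≤ x i := by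
  have := le_of_mem_stab (-LinearMap.proj i) (c := 0) (fun v _ hv => ?_) hx
  · simpa using this
  · rcases hv i with h | h <;> simp [h]

theorem sum_clique_le_one_of_mem_stab {G : SimpleGraph V} {x : V → ℝ} (hx : x ∈ stab G)
    {K : Finset V} (hK : G.IsClique (K : Set V)) : ∑ i ∈ K, x i ≤ 1 := by
  have := le_of_mem_stab (coordSum K).toLinearMap (c := 1) (fun v hv h01 => ?_) hx
  · simpa using this
  · simp only [ContinuousLinearMap.coe_coe, coordSum_apply]
    by_cases h : ∃ i ∈ K, v i = 1
    · obtain ⟨i, hi, hvi⟩ := h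
      rw [Finset.sum_eq_single_of_mem i hi, hvi]
      intro j hj hji
      simpa [hvi] using hv i j (hK hi hj hji.symm)
    · push Not at h
      rw [Finset.sum_eq_zero fun i hi => (h01 i).resolve_right (h i hi)]
      exact zero_le_one

/-- `g 0, …, g (2a)` is a closed walk of odd length `2a+1`. -/
def IsOddClosedWalk (G : SimpleGraph V) (a : ℕ) (g : ℕ → V) : Prop :=
  (∀ k < 2 * a, G.Adj (g k) (g (k + 1))) ∧ G.Adj (g (2 * a)) (g 0)

/-- Closed walks need no distinct vertices, which suits the later induction over chords; injectivity
of the copy matters only for equality of the sums. -/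
theorem IsOddCycle.exists_isOddClosedWalk {G : SimpleGraph V} {a : ℕ} {C : Finset V}
    (hC : IsOddCycle G a C) : ∃ g : ℕ → V, IsOddClosedWalk G a g ∧
      ∀ x : V → ℝ, ∑ i ∈ C, x i = ∑ k ∈ Finset.range (2 * a + 1), x (g k) := by
  classical
  obtain ⟨ha, f, hf⟩ := hC
  refine ⟨fun k => f (Fin.ofNat (2 * a + 1) k), ⟨fun k hk => ?_, ?_⟩, fun x => ?_⟩
  · apply f.toHom.map_adj
    rw [SimpleGraph.cycleGraph_adj']
    right
    rw [Fin.sub_def]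
    simp only [Fin.val_ofNat]
    rw [Nat.mod_eq_of_lt (show k < 2 * a + 1 by omega),
      Nat.mod_eq_of_lt (show k + 1 < 2 * a + 1 by omega),
      show 2 * a + 1 - k + (k + 1) = 1 + (2 * a + 1) by omega, Nat.add_mod_right]
    exact Nat.mod_eq_of_lt (by omega)
  · apply f.toHom.map_adj
    rw [SimpleGraph.cycleGraph_adj']
    right
    rw [Fin.sub_def]
    simp only [Fin.val_ofNat]
    rw [Nat.mod_eq_of_lt (show 2 * a < 2 * a + 1 by omega),
      show 2 * a + 1 - 2 * a + 0 % (2 * a + 1) = 1 by simp]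
    exact Nat.mod_eq_of_lt (by omega)
  · have hCim : C = Finset.univ.image f := by
      ext i
      rw [← Finset.mem_coe, ← hf]
      simp
    have hinj : Function.Injective f := f.injective
    rw [hCim, Finset.sum_image hinj.injOn, Finset.sum_range]
    refine Finset.sum_congr rfl fun k _ => ?_
    congr 2
    ext
    simp

/-- On a 0/1 vertex, summing over all `2a+1` edges counts each position twice, so twice the sum is
at most `2a+1`; integrality rounds down to `a`. -/
theorem sum_oddClosedWalk_le_of_mem_stab {G : SimpleGraph V} {a : ℕ} {g : ℕ → V}
    (hg : IsOddClosedWalk G a g) {x : V → ℝ} (hx : x ∈ stab G) :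
    ∑ k ∈ Finset.range (2 * a + 1), x (g k) ≤ a := by
  have := le_of_mem_stab (∑ k ∈ Finset.range (2 * a + 1), LinearMap.proj (g k)) (c := a)
    (fun v hv h01 => ?_) hx
  · simpa using this
  · have hu : ∀ i, ∃ u : ℕ, v i = u := fun i => by
      rcases h01 i with h | h
      · exact ⟨0, by simp [h]⟩
      · exact ⟨1, by simp [h]⟩
    choose u hu using hu
    have hedge : ∀ i j, G.Adj i j → u i + u j ≤ 1 := by
      intro i j hij
      have h := hv i j hij
      have hi := h01 i
      have hj := h01 j
      rw [hu] at hi hj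
      rw [hu, hu] at h
      norm_cast at h hi hj
      rcases hi with hi | hi <;> rcases hj with hj | hj <;> simp_all
    have hsum : ∑ k ∈ Finset.range (2 * a), (u (g k) + u (g (k + 1))) ≤ 2 * a := by
      calc _ ≤ ∑ k ∈ Finset.range (2 * a), 1 :=
            Finset.sum_le_sum fun k hk => hedge _ _ (hg.1 k (Finset.mem_range.1 hk))
        _ = 2 * a := by simp
    have h0 := hedge _ _ hg.2
    rw [Finset.sum_add_distrib] at hsum
    have h1 := Finset.sum_range_succ (fun k => u (g k)) (2 * a)
    have h2 := Finset.sum_range_succ' (fun k => u (g k)) (2 * a)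
    have : ∑ k ∈ Finset.range (2 * a + 1), u (g k) ≤ a := by omega
    simp only [LinearMap.sum_apply, LinearMap.proj_apply, hu]
    exact_mod_cast this

/-- The stable set polytope of an `h`-perfect graph is described by the nonnegativity, clique and
odd cycle inequalities. -/
theorem IsHPerfect.mem_stab [Fintype V] {G : SimpleGraph V} (hG : IsHPerfect G) {x : V → ℝ}
    (h0 : ∀ i, 0 ≤ x i) (hK : ∀ K : Finset V, G.IsClique (K : Set V) → ∑ i ∈ K, x i ≤ 1)
    (hC : ∀ a g, IsOddClosedWalk G a g → ∑ k ∈ Finset.range (2 * a + 1), x (g k) ≤ a) :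
    x ∈ stab G := by
  by_contra hx
  obtain ⟨l, c, hle, hlx, hF⟩ :=
    exists_isFacet_of_notMem_convexHull (finite_stab_vertices G) (affineSpan_stab G) hx
  change IsFacet (stab G) {y ∈ stab G | l y = c} at hF
  -- A valid inequality tight on the violated facet is a positive multiple of `l ≤ c`, so `x`
  -- violates it too.
  have key : ∀ (A : (V → ℝ) →ₗ[ℝ] ℝ) (b : ℝ), A ≠ 0 → (∀ y ∈ stab G, A y ≤ b) →
      (∀ y ∈ {y ∈ stab G | l y = c}, A y = b) → b < A x := by
    intro A b hA hAb hAF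
    obtain ⟨t, ht, rfl, rfl⟩ := hF.exists_smul_eq (vectorSpan_stab G) (l := l.toLinearMap) hle rfl
      hA hAb hAF
    simpa [ht] using hlx
  have hne := hF.2.1
  rcases hG _ hF with ⟨i, hi⟩ | ⟨K, hKc, hi⟩ | ⟨a, C, hCc, hi⟩
  · have := key (-LinearMap.proj i) 0 (fun h => by
      have := LinearMap.congr_fun h (fun _ => 1)
      simp at this) (fun y hy => by simpa using nonneg_of_mem_stab hy i) (fun y hy => by
      rw [hi] at hy
      simpa using hy.2)
    have h := h0 i
    simp at this
    linarith
  · rw [hi] at hne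
    have hKne : K.Nonempty := by
      rw [Finset.nonempty_iff_ne_empty]
      rintro rfl
      obtain ⟨y, -, hy⟩ := hne
      simp at hy
    have := key (coordSum K).toLinearMap 1
      (fun h => coordSum_ne_zero hKne (ContinuousLinearMap.coe_injective h))
      (fun y hy => by simpa using sum_clique_le_one_of_mem_stab hy hKc) (fun y hy => by
      rw [hi] at hy
      simpa using hy.2)
    have h := hK K hKc
    simp at this
    linarith
  · obtain ⟨g, hg, hgs⟩ := hCc.exists_isOddClosedWalk
    have hCne : C.Nonempty := by
      obtain ⟨ha, f, hf⟩ := hCc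
      exact ⟨f 0, by rw [← Finset.mem_coe, ← hf]; exact ⟨0, rfl⟩⟩
    have := key (coordSum C).toLinearMap a
      (fun h => coordSum_ne_zero hCne (ContinuousLinearMap.coe_injective h))
      (fun y hy => by simpa [hgs] using sum_oddClosedWalk_le_of_mem_stab hg hy) (fun y hy => by
      rw [hi] at hy
      simpa using hy.2)
    have h := hC a g hg
    simp [hgs] at this
    linarith

open Classical in
/-- If all the roundings `⌊N x⌋` are sums of `N` independent sets, then `x` lies in the stable
set polytope. -/
theorem mem_stab_of_decompositions [Fintype V] {G : SimpleGraph V} {x : V → ℝ}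
    (hx : ∀ i, 0 ≤ x i)
    (h : ∀ N : ℕ, 0 < N → ∃ f : ℕ → Finset V, (∀ t < N, G.IsIndepSet (f t : Set V)) ∧
      ∀ i, ∑ t ∈ Finset.range N, (if i ∈ f t then 1 else 0) = ⌊x i * N⌋₊) :
    x ∈ stab G := by
  have hlim : Filter.Tendsto (fun N : ℕ => fun i => (⌊x i * (N : ℝ)⌋₊ : ℝ) / (N : ℝ))
      Filter.atTop (nhds x) :=
    tendsto_pi_nhds.2 fun i =>
      (tendsto_nat_floor_mul_div_atTop (hx i)).comp tendsto_natCast_atTop_atTop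
  refine (isClosed_stab G).mem_of_tendsto hlim ?_
  filter_upwards [Filter.eventually_gt_atTop 0] with N hN
  obtain ⟨f, hf, hfx⟩ := h N hN
  have hconv : Convex ℝ (stab G) := convex_convexHull ℝ _
  have hN' : (N : ℝ) ≠ 0 := by positivity
  -- The rounded point `⌊N x⌋ / N` is the mean of `N` indicator vectors.
  have := hconv.sum_mem (t := Finset.range N) (w := fun _ => (1 / N : ℝ))
    (z := fun t i => if i ∈ f t then (1 : ℝ) else 0) (fun _ _ => by positivity)
    (by simp [hN']) (fun t ht => indicator_mem_stab (hf t (Finset.mem_range.1 ht)))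
  convert this using 1
  ext i
  rw [← hfx i, ← Finset.smul_sum]
  simp
  ring

end Stab

/-! ### Perfect graphs -/

section Perfect

variable {V : Type*}

theorem IsPerfect.colorable_induce [Finite V] {G : SimpleGraph V} (hG : IsPerfect G) (s : Set V) {N : ℕ}
    (hN : ∀ K : Finset V, G.IsClique (K : Set V) → (K : Set V) ⊆ s → K.card ≤ N) :
    (G.induce s).Colorable N := by
  classical
  rw [← SimpleGraph.chromaticNumber_le_iff_colorable, hG s]
  obtain ⟨t, ht⟩ := (G.induce s).exists_isNClique_cliqueNum
  rw [← ht.card_eq, ← Finset.card_map (Function.Embedding.subtype (· ∈ s))]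
  norm_cast
  apply hN
  · intro u hu v hv huv
    simp only [Finset.coe_map, Function.Embedding.subtype_apply, Set.mem_image] at hu hv
    obtain ⟨u, hu, rfl⟩ := hu
    obtain ⟨v, hv, rfl⟩ := hv
    exact ht.isClique hu hv (fun h => huv (by rw [h]))
  · intro u hu
    simp only [Finset.coe_map, Function.Embedding.subtype_apply, Set.mem_image] at hu
    obtain ⟨u, hu, rfl⟩ := hu
    exact u.2

theorem sum_floor_le {s : Finset V} {x : V → ℝ} (hx : ∀ i, 0 ≤ x i) {b N : ℕ}
    (h : ∑ i ∈ s, x i ≤ b) : ∑ i ∈ s, ⌊x i * N⌋₊ ≤ b * N := by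
  have h1 : ∑ i ∈ s, (⌊x i * N⌋₊ : ℝ) ≤ b * N := by
    calc _ ≤ ∑ i ∈ s, x i * N :=
          Finset.sum_le_sum fun i _ => Nat.floor_le (mul_nonneg (hx i) (Nat.cast_nonneg N))
      _ = (∑ i ∈ s, x i) * N := by rw [Finset.sum_mul]
      _ ≤ _ := by gcongr
  exact_mod_cast h1

variable [Fintype V]

open Classical in
/-- In a perfect graph, integer weights `y` whose sum over each clique is at most `N` can be
written as the sum of `N` independent sets. -/
theorem IsPerfect.exists_decomposition {G : SimpleGraph V} (hG : IsPerfect G) (n : ℕ) :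
    ∀ (y : V → ℕ) (N : ℕ), ∑ i, y i = n →
      (∀ K : Finset V, G.IsClique (K : Set V) → ∑ i ∈ K, y i ≤ N) →
      ∃ f : ℕ → Finset V, (∀ t < N, G.IsIndepSet (f t : Set V)) ∧
        ∀ i, ∑ t ∈ Finset.range N, (if i ∈ f t then 1 else 0) = y i := by
  induction n using Nat.strong_induction_on with
  | _ n ih =>
  intro y N hn hK
  -- For 0/1 weights the decomposition is a colouring of the support with `N` colours, from
  -- perfection of the induced subgraph.
  by_cases hy : ∀ i, y i ≤ 1
  · have hcol : (G.induce {i | y i = 1}).Colorable N := by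
      refine hG.colorable_induce _ fun K hKc hKs => ?_
      have := hK K hKc
      rw [Finset.sum_congr rfl fun i hi => (show y i = 1 from hKs hi)] at this
      simpa using this
    obtain ⟨C⟩ := hcol
    refine ⟨fun t => Finset.univ.filter fun i => ∃ h : y i = 1, (C ⟨i, h⟩ : ℕ) = t,
      fun t _ => ?_, fun i => ?_⟩
    · intro u hu v hv _ hadj
      simp only [Finset.coe_filter, Finset.mem_univ, true_and, Set.mem_ofPred_eq] at hu hv
      obtain ⟨hu, hut⟩ := hu
      obtain ⟨hv, hvt⟩ := hv
      exact C.valid (v := ⟨u, hu⟩) (w := ⟨v, hv⟩) hadj (Fin.ext (hut.trans hvt.symm))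
    · by_cases hi : y i = 1
      · rw [hi, Finset.sum_eq_single_of_mem (C ⟨i, hi⟩ : ℕ) (by simp)]
        · simp [hi]
        · intro t _ ht
          simp [hi, ht.symm]
      · have : y i = 0 := by have := hy i; omega
        simp [this]
  · push Not at hy
    obtain ⟨i, hi⟩ := hy
    have hiN := hK {i} (by simp)
    rw [Finset.sum_singleton] at hiN
    obtain ⟨N, rfl⟩ : ∃ M, N = M + 1 := ⟨N - 1, by omega⟩
    have hlt : ∑ j, (y j - if j = i then 1 else 0) < n := by
      rw [← hn]
      exact Finset.sum_lt_sum (fun j _ => Nat.sub_le _ _) ⟨i, Finset.mem_univ i, by simp; omega⟩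
    -- Lower the weight of a vertex `i` with `y i ≥ 2` by one and decompose. Since `i` keeps
    -- positive weight, some part `f t₀` contains it; this part is then removed from the original
    -- `y`.
    obtain ⟨f, hf, hfy⟩ := ih _ hlt (fun j => y j - if j = i then 1 else 0) (N + 1) rfl
      fun K hKc => (Finset.sum_le_sum fun j _ => Nat.sub_le _ _).trans (hK K hKc)
    obtain ⟨t₀, ht₀, hit₀⟩ : ∃ t < N + 1, i ∈ f t := by
      by_contra! h
      have := hfy i
      rw [Finset.sum_eq_zero fun t ht => by simp [h t (Finset.mem_range.1 ht)]] at this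
      simp at this
      omega
    have hle : ∀ j, (if j ∈ f t₀ then 1 else 0) ≤ y j := by
      intro j
      refine le_trans ?_ ((hfy j).trans_le (Nat.sub_le _ _))
      exact Finset.single_le_sum (f := fun t => if j ∈ f t then 1 else 0) (fun _ _ => Nat.zero_le _)
        (Finset.mem_range.2 ht₀)
    have hlt' : ∑ j, (y j - if j ∈ f t₀ then 1 else 0) < n := by
      rw [← hn]
      exact Finset.sum_lt_sum (fun j _ => Nat.sub_le _ _)
        ⟨i, Finset.mem_univ i, by simp [hit₀]; omega⟩
    obtain ⟨f', hf', hfy'⟩ := ih _ hlt' (fun j => y j - if j ∈ f t₀ then 1 else 0) N rfl (by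
      intro K hKc
      have hsplit : ∑ j ∈ K, (y j - if j ∈ f t₀ then 1 else 0) +
          ∑ j ∈ K, (if j ∈ f t₀ then 1 else 0) = ∑ j ∈ K, y j := by
        rw [← Finset.sum_add_distrib]
        exact Finset.sum_congr rfl fun j _ => Nat.sub_add_cancel (hle j)
      -- A clique through `i` loses at least one from `N + 1`. A clique avoiding `i` has unchanged
      -- weight in the decomposition and meets each of the `N` parts other than `f t₀` at most once.
      by_cases hiK : i ∈ K
      · have h1 : 1 ≤ ∑ j ∈ K, (if j ∈ f t₀ then 1 else 0) := by
          refine le_trans (by simp [hit₀]) (Finset.single_le_sum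
            (f := fun j => if j ∈ f t₀ then 1 else 0) (fun _ _ => Nat.zero_le _) hiK)
        have := hK K hKc
        omega
      · have h1 : ∑ j ∈ K, y j =
            ∑ t ∈ Finset.range (N + 1), ∑ j ∈ K, (if j ∈ f t then 1 else 0) := by
          rw [Finset.sum_comm]
          refine Finset.sum_congr rfl fun j hj => ?_
          rw [hfy j, if_neg (by rintro rfl; exact hiK hj), Nat.sub_zero]
        have h2 : ∀ t ∈ (Finset.range (N + 1)).erase t₀,
            ∑ j ∈ K, (if j ∈ f t then 1 else 0) ≤ 1 := by
          intro t ht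
          rw [Finset.sum_boole, Nat.cast_id, Finset.card_le_one]
          intro u hu v hv
          rw [Finset.mem_filter] at hu hv
          by_contra huv
          exact hf t (Finset.mem_range.1 (Finset.mem_of_mem_erase ht)) hu.2 hv.2 huv
            (hKc hu.1 hv.1 huv)
        have h3 := Finset.sum_le_sum h2
        rw [← Finset.add_sum_erase _ _ (Finset.mem_range.2 ht₀)] at h1
        simp only [Finset.sum_const, Finset.card_erase_of_mem (Finset.mem_range.2 ht₀),
          Finset.card_range] at h3
        simp at h3
        simp at hsplit h1 ⊢
        omega)
    refine ⟨Function.update f' N (f t₀), fun t ht => ?_, fun j => ?_⟩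
    · rcases Nat.lt_succ_iff_lt_or_eq.1 ht with h | rfl
      · rw [Function.update_of_ne h.ne]
        exact hf' t h
      · rw [Function.update_self]
        exact hf t₀ ht₀
    · rw [Finset.sum_range_succ, Function.update_self]
      rw [Finset.sum_congr rfl fun t ht => by
        rw [Function.update_of_ne (Finset.mem_range.1 ht).ne], hfy' j]
      exact Nat.sub_add_cancel (hle j)

theorem IsPerfect.mem_stab {G : SimpleGraph V} (hG : IsPerfect G) {x : V → ℝ}
    (h0 : ∀ i, 0 ≤ x i) (hK : ∀ K : Finset V, G.IsClique (K : Set V) → ∑ i ∈ K, x i ≤ 1) :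
    x ∈ stab G :=
  mem_stab_of_decompositions h0 fun N _ => hG.exists_decomposition _ _ N rfl fun K hKc => by
    simpa using sum_floor_le (b := 1) (N := N) h0 (by simpa using hK K hKc)

theorem IsPerfect.isHPerfect {G : SimpleGraph V} (hG : IsPerfect G) : IsHPerfect G := by
  intro F hF
  -- The empty clique is excluded because its functional is zero.
  let A : V ⊕ {K : Finset V // G.IsClique (K : Set V) ∧ K.Nonempty} → (V → ℝ) →L[ℝ] ℝ :=
    Sum.elim (fun i => -coordSum {i}) (fun K => coordSum K.1)
  obtain ⟨i | K, hi⟩ := hF.exists_eq_of_description (vectorSpan_stab G) A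
    (Sum.elim (fun _ => 0) (fun _ => 1)) (by
      rintro (i | K)
      · exact neg_ne_zero.2 (coordSum_ne_zero (Finset.singleton_nonempty i))
      · exact coordSum_ne_zero K.2.2) (by
      intro x
      constructor
      · rintro hx (i | K)
        · simpa [A] using nonneg_of_mem_stab hx i
        · simpa [A] using sum_clique_le_one_of_mem_stab hx K.2.1
      · intro h
        refine hG.mem_stab (fun i => by simpa [A] using h (.inl i)) fun K hK => ?_
        rcases K.eq_empty_or_nonempty with rfl | hne
        · simp
        · simpa [A] using h (.inr ⟨K, hK, hne⟩))
  · exact .inl ⟨i, by simpa [A] using hi⟩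
  · exact .inr (.inl ⟨K.1, K.2.1, by simpa [A] using hi⟩)

end Perfect

/-! ### Odd cycles -/

section OddCycle

/-- Integers between prescribed bounds with a prescribed sum. -/
theorem exists_sum_eq_of_bounds (lo hi : ℕ → ℤ) (n : ℕ) (h : ∀ k < n, lo k ≤ hi k) (T : ℤ)
    (hlo : ∑ k ∈ Finset.range n, lo k ≤ T) (hhi : T ≤ ∑ k ∈ Finset.range n, hi k) :
    ∃ d : ℕ → ℤ, (∀ k < n, lo k ≤ d k ∧ d k ≤ hi k) ∧ ∑ k ∈ Finset.range n, d k = T := by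
  induction n generalizing T with
  | zero => exact ⟨lo, by simp, by simp at *; omega⟩
  | succ n ih =>
    rw [Finset.sum_range_succ] at hlo hhi
    have hle : ∑ k ∈ Finset.range n, lo k ≤ ∑ k ∈ Finset.range n, hi k :=
      Finset.sum_le_sum fun k hk => h k (by have := Finset.mem_range.1 hk; omega)
    have hn := h n (by omega)
    -- The last entry is the least one that leaves a remainder the earlier entries can still absorb.
    obtain ⟨e, he1, he2, he3, he4⟩ : ∃ e, lo n ≤ e ∧ e ≤ hi n ∧
        ∑ k ∈ Finset.range n, lo k ≤ T - e ∧ T - e ≤ ∑ k ∈ Finset.range n, hi k :=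
      ⟨max (lo n) (T - ∑ k ∈ Finset.range n, hi k), by omega, by omega, by omega, by omega⟩
    obtain ⟨d, hd, hds⟩ := ih (fun k hk => h k (by omega)) (T - e) he3 he4
    refine ⟨Function.update d n e, fun k hk => ?_, ?_⟩
    · rcases Nat.lt_succ_iff_lt_or_eq.1 hk with h' | rfl
      · rw [Function.update_of_ne h'.ne]
        exact hd k h'
      · rw [Function.update_self]
        exact ⟨he1, he2⟩
    · rw [Finset.sum_range_succ, Function.update_self, Finset.sum_congr rfl fun k hk => by
        rw [Function.update_of_ne (Finset.mem_range.1 hk).ne], hds]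
      omega

/-- The filter is the arc of length `y` starting at `s` on the circle ℤ/N, parametrized by `r ↦ r +
s`. -/
theorem card_filter_sub_emod_lt {N : ℕ} (hN : 0 < N) (s : ℤ) {y : ℕ} (hy : y ≤ N) :
    ((Finset.range N).filter fun t : ℕ => ((t : ℤ) - s) % N < y).card = y := by
  have hN' : (0 : ℤ) < N := by exact_mod_cast hN
  refine (Finset.card_bij (s := Finset.range y)
    (fun r _ => (((r : ℤ) + s) % N).toNat) ?_ ?_ ?_).symm.trans (Finset.card_range y)
  · intro r hr
    rw [Finset.mem_range] at hr
    have h0 := Int.emod_nonneg ((r : ℤ) + s) hN'.ne'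
    have h1 := Int.emod_lt_of_pos ((r : ℤ) + s) hN'
    rw [Finset.mem_filter, Finset.mem_range, Int.toNat_of_nonneg h0,
      Int.emod_sub_emod, add_sub_cancel_right, Int.emod_eq_of_lt (a := (r : ℤ)) (by omega) (by omega)]
    omega
  · intro r hr r' hr' h
    rw [Finset.mem_range] at hr hr'
    have h0 := Int.emod_nonneg ((r : ℤ) + s) hN'.ne'
    have h0' := Int.emod_nonneg ((r' : ℤ) + s) hN'.ne'
    have h2 : ((r : ℤ) + s) % N = ((r' : ℤ) + s) % N := by omega
    have h3 : (r : ℤ) % N = (r' : ℤ) % N := by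
      have := congrArg (fun z => (z - s) % (N : ℤ)) h2
      simpa [Int.emod_sub_emod] using this
    rw [Int.emod_eq_of_lt (by omega) (by omega), Int.emod_eq_of_lt (by omega) (by omega)] at h3
    omega
  · intro t ht
    rw [Finset.mem_filter, Finset.mem_range] at ht
    have h0 := Int.emod_nonneg ((t : ℤ) - s) hN'.ne'
    refine ⟨(((t : ℤ) - s) % N).toNat, ?_, ?_⟩
    · rw [Finset.mem_range]
      omega
    · rw [Int.toNat_of_nonneg h0, Int.emod_add_emod, sub_add_cancel,
        Int.emod_eq_of_lt (by omega) (by omega), Int.toNat_natCast]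

/-- Disjointness of arcs: a shift `d ≥ y` clears the first arc, and `d + z ≤ N` keeps the second
from running round into it. -/
theorem le_emod_sub_of_emod_lt {N t s d y z : ℤ} (hyd : y ≤ d) (hdz : d ≤ N - z) (hz : 0 ≤ z)
    (hN : 0 < N) (h : (t - s) % N < y) : z ≤ (t - (s + d)) % N := by
  have h0 := Int.emod_nonneg (t - s) hN.ne'
  have : (t - (s + d)) % N = (t - s) % N - d + N := by
    rw [← sub_sub, ← Int.emod_sub_emod, ← Int.add_emod_right,
      Int.emod_eq_of_lt (by omega) (by omega)]
  omega

/-- Two vertices of a cycle graph are adjacent if and only if one is the cyclic successor of the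
other. -/
theorem cycleGraph_adj_cases {n : ℕ} {u v : Fin (n + 1)}
    (h : (SimpleGraph.cycleGraph (n + 1)).Adj u v) :
    (v.val = u.val + 1 ∨ (u.val = n ∧ v.val = 0)) ∨
      (u.val = v.val + 1 ∨ (v.val = n ∧ u.val = 0)) := by
  rw [SimpleGraph.cycleGraph_adj', Fin.sub_def, Fin.sub_def] at h
  simp only at h
  have hu := u.2
  have hv := v.2
  have key : ∀ p q : ℕ, p < n + 1 → q < n + 1 → (n + 1 - q + p) % (n + 1) = 1 →
      p = q + 1 ∨ (q = n ∧ p = 0) := by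
    intro p q hp hq h
    rcases le_or_gt q p with hqp | hqp
    · rw [show n + 1 - q + p = (p - q) + (n + 1) by omega, Nat.add_mod_right,
        Nat.mod_eq_of_lt (by omega)] at h
      omega
    · rw [Nat.mod_eq_of_lt (by omega)] at h
      omega
  rcases h with h | h
  · exact .inr (key _ _ hu hv h)
  · exact .inl (key _ _ hv hu h)

theorem cycleGraph_adj_of_val_eq {n : ℕ} (hn : 1 ≤ n) {u v : Fin (n + 1)}
    (h : v.val = u.val + 1 ∨ (u.val = n ∧ v.val = 0)) :
    (SimpleGraph.cycleGraph (n + 1)).Adj u v := by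
  rw [SimpleGraph.cycleGraph_adj', Fin.sub_def, Fin.sub_def]
  have hu := u.2
  right
  simp only
  rcases h with h | ⟨h, h'⟩
  · rw [h, show n + 1 - u.val + (u.val + 1) = 1 + (n + 1) by omega, Nat.add_mod_right,
      Nat.mod_eq_of_lt (by omega)]
  · rw [h, h', show n + 1 - n + 0 = 1 by omega, Nat.mod_eq_of_lt (by omega)]

/-- Integer weights on the odd cycle of length `2a+1` with edge sums at most `N` and total at most
`a N` are sums of `N` independent sets. -/
theorem cycleGraph_exists_decomposition {a N : ℕ} (ha : 1 ≤ a) (hN : 0 < N)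
    (y : Fin (2 * a + 1) → ℕ)
    (hedge : ∀ u v, (SimpleGraph.cycleGraph (2 * a + 1)).Adj u v → y u + y v ≤ N)
    (hsum : ∑ i, y i ≤ a * N) :
    ∃ f : ℕ → Finset (Fin (2 * a + 1)),
      (∀ t < N, (SimpleGraph.cycleGraph (2 * a + 1)).IsIndepSet
        (f t : Set (Fin (2 * a + 1)))) ∧
      ∀ i, ∑ t ∈ Finset.range N, (if i ∈ f t then 1 else 0) = y i := by
  have hN' : (0 : ℤ) < N := by exact_mod_cast hN
  let Y : ℕ → ℤ := fun k => y (Fin.ofNat (2 * a + 1) k)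
  have hY : ∀ u : Fin (2 * a + 1), Y u = y u := fun u => by simp [Y]
  have hYsum : ∑ k ∈ Finset.range (2 * a + 1), Y k = ∑ i, (y i : ℤ) := by
    rw [Finset.sum_range]
    exact Finset.sum_congr rfl fun i _ => hY i
  have hYlast : Y (2 * a + 1) = Y 0 := by
    simp only [Y]
    congr 2
    ext
    simp
  have hYsum' : ∑ k ∈ Finset.range (2 * a + 1), Y (k + 1) = ∑ i, (y i : ℤ) := by
    have h1 := Finset.sum_range_succ Y (2 * a + 1)
    have h2 := Finset.sum_range_succ' Y (2 * a + 1)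
    omega
  have hYedge : ∀ k < 2 * a + 1, Y k + Y (k + 1) ≤ N := by
    intro k hk
    have : y (Fin.ofNat (2 * a + 1) k) + y (Fin.ofNat (2 * a + 1) (k + 1)) ≤ N := by
      apply hedge
      apply cycleGraph_adj_of_val_eq (by omega)
      simp only [Fin.val_ofNat]
      rw [Nat.mod_eq_of_lt hk]
      rcases Nat.lt_or_ge (k + 1) (2 * a + 1) with h | h
      · exact .inl (Nat.mod_eq_of_lt h)
      · obtain rfl : k = 2 * a := by omega
        simp
    simp only [Y]
    exact_mod_cast this
  have hsumZ : ∑ i, (y i : ℤ) ≤ a * N := by exact_mod_cast hsum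
  -- Vertex `k` receives an arc of length `Y k`, shifted by `d k` to the next arc. The bounds on `d
  -- k` make consecutive arcs disjoint, and a total shift that is a multiple of `N` closes the
  -- cycle. The total `a * N` is attainable: the lower bounds sum to at most `a * N` by `hsum`, the
  -- upper ones to at least `(a + 1) * N`.
  obtain ⟨d, hd, hds⟩ := exists_sum_eq_of_bounds Y (fun k => N - Y (k + 1)) (2 * a + 1)
    (fun k hk => by linarith [hYedge k hk]) (a * N) (by rw [hYsum]; exact hsumZ) (by
      rw [Finset.sum_sub_distrib, hYsum']
      simp only [Finset.sum_const, Finset.card_range, nsmul_eq_mul]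
      push_cast
      nlinarith)
  let s : ℕ → ℤ := fun k => ∑ j ∈ Finset.range k, d j
  have hss : ∀ k, s (k + 1) = s k + d k := fun k => Finset.sum_range_succ _ _
  have hstep : ∀ u v : Fin (2 * a + 1), (v.val = u.val + 1 ∨ (u.val = 2 * a ∧ v.val = 0)) →
      ∀ t : ℤ, (t - s u) % N < y u → (y v : ℤ) ≤ (t - s v) % N := by
    intro u v huv t ht
    have hdu := hd u u.2
    rw [hY] at hdu
    have hv : Y (u + 1) = y v := by
      rcases huv with h | ⟨h, h'⟩
      · rw [← h, hY]
      · rw [h, hYlast, ← h', hY]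
    rw [hv] at hdu
    have h1 := le_emod_sub_of_emod_lt hdu.1 hdu.2 (by positivity) hN' ht
    rcases huv with h | ⟨h, h'⟩
    · rwa [h, hss]
    -- At the wrap-around the accumulated shift is `a * N`, which vanishes modulo `N`.
    · rw [← hss, h] at h1
      change (y v : ℤ) ≤ (t - ∑ j ∈ Finset.range (2 * a + 1), d j) % N at h1
      rw [hds, Int.sub_mul_emod_self_right] at h1
      simpa [h', s] using h1
  refine ⟨fun t => Finset.univ.filter fun i => ((t : ℤ) - s i) % N < y i, ?_, ?_⟩
  · intro t _ u hu v hv _ huv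
    simp only [Finset.coe_filter, Finset.mem_univ, true_and, Set.mem_ofPred_eq] at hu hv
    rcases cycleGraph_adj_cases huv with h | h
    · exact absurd hv (hstep u v h t hu).not_gt
    · exact absurd hu (hstep v u h t hv).not_gt
  · intro i
    have hi : y i ≤ N := by
      have h1 := hYedge i i.2
      have h2 : 0 ≤ Y (i + 1) := by positivity
      rw [hY] at h1
      omega
    simp only [Finset.mem_filter, Finset.mem_univ, true_and, Finset.sum_boole, Nat.cast_id]
    exact card_filter_sub_emod_lt hN _ hi

/-- The arc decomposition needs only the edge inequalities (cliques of size two) and the inequality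
of the whole cycle, so these with nonnegativity already describe the polytope. -/
theorem isHPerfect_cycleGraph {a : ℕ} (ha : 1 ≤ a) :
    IsHPerfect (SimpleGraph.cycleGraph (2 * a + 1)) := by
  classical
  set G := SimpleGraph.cycleGraph (2 * a + 1) with hG
  have hC : IsOddCycle G a Finset.univ :=
    ⟨ha, SimpleGraph.Copy.id G, by simp⟩
  intro F hF
  let V := Fin (2 * a + 1)
  let A : V ⊕ {K : Finset V // G.IsClique (K : Set V) ∧ K.Nonempty} ⊕ Unit → (V → ℝ) →L[ℝ] ℝ :=
    Sum.elim (fun i => -coordSum {i})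
      (Sum.elim (fun K => coordSum K.1) (fun _ => coordSum Finset.univ))
  obtain ⟨i | K | u, hi⟩ := hF.exists_eq_of_description (vectorSpan_stab G) A
    (Sum.elim (fun _ => 0) (Sum.elim (fun _ => 1) (fun _ => a))) (by
      rintro (i | K | u)
      · exact neg_ne_zero.2 (coordSum_ne_zero (Finset.singleton_nonempty i))
      · exact coordSum_ne_zero K.2.2
      · exact coordSum_ne_zero (s := (Finset.univ : Finset V)) ⟨0, Finset.mem_univ _⟩) (by
      intro x
      constructor
      · rintro hx (i | K | u)
        · simpa [A] using nonneg_of_mem_stab hx i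
        · simpa [A] using sum_clique_le_one_of_mem_stab hx K.2.1
        · obtain ⟨g, hg, hgs⟩ := hC.exists_isOddClosedWalk
          have := sum_oddClosedWalk_le_of_mem_stab hg hx
          rw [← hgs] at this
          simpa [A] using this
      · intro h
        have h0 : ∀ i, 0 ≤ x i := fun i => by simpa [A] using h (.inl i)
        refine mem_stab_of_decompositions h0 fun N hN => ?_
        convert cycleGraph_exists_decomposition ha hN (fun i => ⌊x i * N⌋₊) ?_ ?_
        · intro u v huv
          have hcl : G.IsClique (({u, v} : Finset V) : Set V) := by
            rw [Finset.coe_pair, SimpleGraph.isClique_pair]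
            exact fun _ => huv
          have h1 : ∑ i ∈ {u, v}, x i ≤ 1 := by
            simpa [A] using h (.inr (.inl ⟨{u, v}, hcl, by simp⟩))
          have := sum_floor_le (b := 1) (N := N) h0 (by simpa using h1)
          simpa [Finset.sum_pair huv.ne] using this
        · exact sum_floor_le h0 (by simpa [A] using h (.inr (.inr ()))))
  · exact .inl ⟨i, by simpa [A] using hi⟩
  · exact .inr (.inl ⟨K.1, K.2.1, by simpa [A] using hi⟩)
  · exact .inr (.inr ⟨a, Finset.univ, hC, by simpa [A] using hi⟩)

end OddCycle

/-! ### Pauli strings -/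

section Pauli

theorem pauliMatrix_conjTranspose (p : PauliLabel) :
    (pauliMatrix p).conjTranspose = pauliMatrix p := by
  cases p <;> ext i j <;> fin_cases i <;> fin_cases j <;> simp [pauliMatrix]

theorem pauliString_conjTranspose {m : ℕ} (p : Fin m → PauliLabel) :
    (pauliString p).conjTranspose = pauliString p := by
  ext x y
  simp only [Matrix.conjTranspose_apply, pauliString, Matrix.of_apply, star_prod]
  refine Finset.prod_congr rfl fun k _ => ?_
  rw [← Matrix.conjTranspose_apply, pauliMatrix_conjTranspose]

theorem pauliMatrix_mul_comm_or (p q : PauliLabel) :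
    ∃ ε : ℂ, (ε = 1 ∨ ε = -1) ∧
      pauliMatrix p * pauliMatrix q = ε • (pauliMatrix q * pauliMatrix p) := by
  have h : pauliMatrix p * pauliMatrix q = pauliMatrix q * pauliMatrix p ∨
      pauliMatrix p * pauliMatrix q = -(pauliMatrix q * pauliMatrix p) := by
    cases p <;> cases q <;>
      first
      | left; ext i j; fin_cases i <;> fin_cases j <;> simp [pauliMatrix]; done
      | right; ext i j; fin_cases i <;> fin_cases j <;> simp [pauliMatrix]
  rcases h with h | h
  · exact ⟨1, .inl rfl, by rw [h, one_smul]⟩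
  · exact ⟨-1, .inr rfl, by rw [h, neg_smul, one_smul]⟩

/-- Two Pauli strings commute or anticommute. -/
theorem pauliString_commute_or_anticommute {m : ℕ} (p q : Fin m → PauliLabel) :
    pauliString p * pauliString q = pauliString q * pauliString p ∨
      pauliString p * pauliString q = -(pauliString q * pauliString p) := by
  choose ε hε hmul using fun k => pauliMatrix_mul_comm_or (p k) (q k)
  have hprod : (∏ k, ε k) = 1 ∨ (∏ k, ε k) = -1 :=
    Finset.prod_induction ε (fun z => z = 1 ∨ z = -1)
      (by rintro a b (rfl | rfl) (rfl | rfl) <;> simp) (.inl rfl) (fun k _ => hε k)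
  have h : pauliString p * pauliString q = (∏ k, ε k) • (pauliString q * pauliString p) := by
    ext x y
    rw [Matrix.smul_apply, pauliString_mul_apply, pauliString_mul_apply]
    simp only [hmul, Matrix.smul_apply, smul_eq_mul, Finset.prod_mul_distrib]
  rcases hprod with h' | h'
  · exact .inl (by rw [h, h', one_smul])
  · exact .inr (by rw [h, h', neg_smul, one_smul])

end Pauli

/-! ### Expectation values: the clique inequality and joint eigenstates -/

section Expectation

variable {ι : Type*} [Fintype ι]

theorem trace_mul_conjTranspose_mul_self_nonneg {ρ : Matrix ι ι ℂ} (hρ : ρ.PosSemidef)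
    (A : Matrix ι ι ℂ) : 0 ≤ (ρ * (A.conjTranspose * A)).trace := by
  rw [← mul_assoc, Matrix.trace_mul_comm, ← mul_assoc]
  exact (hρ.mul_mul_conjTranspose_same A).trace_nonneg

theorem star_trace_mul {ρ : Matrix ι ι ℂ} (hρ : ρ.IsHermitian) (A : Matrix ι ι ℂ) :
    star (ρ * A).trace = (ρ * A.conjTranspose).trace := by
  rw [← Matrix.trace_conjTranspose, Matrix.conjTranspose_mul, hρ.eq, Matrix.trace_mul_comm]

theorem trace_mul_eq_ofReal {ρ A : Matrix ι ι ℂ} (hρ : ρ.IsHermitian) (hA : A.conjTranspose = A) :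
    (ρ * A).trace = ((ρ * A).trace.re : ℂ) := by
  have h := star_trace_mul hρ A
  rw [hA] at h
  exact (Complex.conj_eq_iff_re.1 h).symm

/-- The squared expectations of pairwise anticommuting self-adjoint unitaries add up to at
most `1`. -/
theorem sum_sq_expectation_le_one [DecidableEq ι] {κ : Type*} (K : Finset κ)
    (S : κ → Matrix ι ι ℂ) (hS : ∀ i ∈ K, (S i).conjTranspose = S i)
    (hSS : ∀ i ∈ K, S i * S i = 1)
    (hanti : ∀ i ∈ K, ∀ j ∈ K, i ≠ j → S i * S j = -(S j * S i))
    {ρ : Matrix ι ι ℂ} (hρ : IsState ρ) : ∑ i ∈ K, expectation (S i) ρ ^ 2 ≤ 1 := by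
  classical
  set c : κ → ℝ := fun i => expectation (S i) ρ with hc
  set s : ℝ := ∑ i ∈ K, c i ^ 2 with hs
  -- Anticommutation cancels the cross terms, so `A² = s` while `⟨A⟩ = s`. The variance `⟨(A - s)²⟩
  -- = s - s²` is nonnegative, whence `s ≤ 1`.
  set A : Matrix ι ι ℂ := ∑ i ∈ K, (c i : ℂ) • S i with hA
  have hAA : A * A = (s : ℂ) • 1 := by
    have h1 : A * A = ∑ i ∈ K, ∑ j ∈ K, ((c i : ℂ) * c j) • (S i * S j) := by
      rw [hA, Finset.sum_mul_sum]
      refine Finset.sum_congr rfl fun i _ => Finset.sum_congr rfl fun j _ => ?_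
      rw [smul_mul_smul_comm]
    have h2 : A * A = ∑ i ∈ K, ∑ j ∈ K, ((c i : ℂ) * c j) • (S j * S i) := by
      rw [h1, Finset.sum_comm]
      refine Finset.sum_congr rfl fun i _ => Finset.sum_congr rfl fun j _ => ?_
      rw [mul_comm (c j : ℂ)]
    have h3 : A * A + A * A = ∑ i ∈ K, ((2 : ℂ) * (c i : ℂ) ^ 2) • (1 : Matrix ι ι ℂ) := by
      nth_rw 1 [h1]
      rw [h2, ← Finset.sum_add_distrib]
      refine Finset.sum_congr rfl fun i hi => ?_
      rw [← Finset.sum_add_distrib, Finset.sum_eq_single_of_mem i hi]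
      · rw [hSS i hi]
        module
      · intro j hj hji
        rw [hanti i hi j hj hji.symm]
        module
    rw [← Finset.sum_smul, ← Finset.mul_sum] at h3
    have h4 : (2 : ℂ) • (A * A) = (2 : ℂ) • ((s : ℂ) • (1 : Matrix ι ι ℂ)) := by
      rw [two_smul, h3, smul_smul, hs]
      push_cast
      rfl
    exact smul_right_injective _ (two_ne_zero) h4
  have hAh : A.conjTranspose = A := by
    rw [hA, Matrix.conjTranspose_sum]
    refine Finset.sum_congr rfl fun i hi => ?_
    rw [Matrix.conjTranspose_smul, hS i hi]
    simp
  have htr : (ρ * A).trace = s := by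
    rw [hA, Finset.mul_sum, Matrix.trace_sum, hs]
    push_cast
    refine Finset.sum_congr rfl fun i hi => ?_
    rw [Matrix.mul_smul, Matrix.trace_smul, trace_mul_eq_ofReal hρ.1.1 (hS i hi), smul_eq_mul, sq]
    rfl
  have hpos := trace_mul_conjTranspose_mul_self_nonneg hρ.1 (A - (s : ℂ) • 1)
  have hexp : (A - (s : ℂ) • 1).conjTranspose * (A - (s : ℂ) • 1) =
      ((s : ℂ) + s ^ 2) • (1 : Matrix ι ι ℂ) - (2 * (s : ℂ)) • A := by
    rw [Matrix.conjTranspose_sub, hAh, Matrix.conjTranspose_smul, Matrix.conjTranspose_one]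
    simp only [Complex.star_def, Complex.conj_ofReal, sub_mul, mul_sub, hAA, Matrix.smul_mul,
      Matrix.mul_smul, one_mul, mul_one]
    module
  rw [hexp, mul_sub, Matrix.trace_sub, Matrix.mul_smul, Matrix.mul_smul, Matrix.trace_smul,
    Matrix.trace_smul, htr, mul_one, hρ.2] at hpos
  have hreal : (0 : ℝ) ≤ s + s ^ 2 - 2 * s * s := by
    have : ((0 : ℝ) : ℂ) ≤ ((s + s ^ 2 - 2 * s * s : ℝ) : ℂ) := by
      push_cast
      simpa using hpos
    exact_mod_cast this
  by_contra! h
  nlinarith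

/-- Commuting involutions have a common eigenvector with eigenvalues `±1`. -/
theorem exists_common_eigenvector [DecidableEq ι] [Nonempty ι] {κ : Type*} (I : Finset κ)
    (S : κ → Matrix ι ι ℂ) (hSS : ∀ i ∈ I, S i * S i = 1)
    (hcomm : ∀ i ∈ I, ∀ j ∈ I, S i * S j = S j * S i) :
    ∃ v : ι → ℂ, v ≠ 0 ∧ ∀ i ∈ I, S i *ᵥ v = v ∨ S i *ᵥ v = -v := by
  classical
  induction I using Finset.induction_on with
  | empty =>
    obtain ⟨k⟩ := ‹Nonempty ι›
    exact ⟨Pi.single k 1, by simp, by simp⟩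
  | insert i I _ ih =>
    obtain ⟨v, hv, hvI⟩ := ih (fun j hj => hSS j (Finset.mem_insert_of_mem hj))
      (fun j hj k hk => hcomm j (Finset.mem_insert_of_mem hj) k (Finset.mem_insert_of_mem hk))
    -- The vector `v + S i v` is fixed by `S i`; if it vanishes, `v` itself has eigenvalue `-1`.
    by_cases h : v + S i *ᵥ v = 0
    · refine ⟨v, hv, fun j hj => ?_⟩
      rcases Finset.mem_insert.1 hj with rfl | hj
      · exact .inr (eq_neg_of_add_eq_zero_right h)
      · exact hvI j hj
    · refine ⟨v + S i *ᵥ v, h, fun j hj => ?_⟩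
      rcases Finset.mem_insert.1 hj with rfl | hj'
      · left
        rw [Matrix.mulVec_add, Matrix.mulVec_mulVec, hSS j hj, Matrix.one_mulVec, add_comm]
      · rw [Matrix.mulVec_add, Matrix.mulVec_mulVec, hcomm j hj i (Finset.mem_insert_self _ _),
          ← Matrix.mulVec_mulVec]
        rcases hvI j hj' with h' | h' <;> rw [h']
        · exact .inl rfl
        · right
          rw [Matrix.mulVec_neg]
          abel

theorem exists_isState_sq_expectation_eq_one [DecidableEq ι] [Nonempty ι] {κ : Type*}
    (I : Finset κ) (S : κ → Matrix ι ι ℂ) (hSS : ∀ i ∈ I, S i * S i = 1)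
    (hcomm : ∀ i ∈ I, ∀ j ∈ I, S i * S j = S j * S i) :
    ∃ ρ : Matrix ι ι ℂ, IsState ρ ∧ ∀ i ∈ I, expectation (S i) ρ ^ 2 = 1 := by
  obtain ⟨v, hv, hvI⟩ := exists_common_eigenvector I S hSS hcomm
  set n : ℂ := v ⬝ᵥ star v with hn
  have hn0 : 0 < n := Matrix.dotProduct_self_star_pos_iff.2 hv
  set ρ : Matrix ι ι ℂ := n⁻¹ • Matrix.vecMulVec v (star v) with hρ
  have hstate : IsState ρ := by
    refine ⟨(Matrix.posSemidef_vecMulVec_self_star v).smul (inv_nonneg.2 hn0.le), ?_⟩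
    rw [hρ, Matrix.trace_smul, Matrix.trace_vecMulVec, smul_eq_mul, ← hn, inv_mul_cancel₀ hn0.ne']
  refine ⟨ρ, hstate, fun i hi => ?_⟩
  have hS : ∀ ε : ℂ, S i *ᵥ v = ε • v → (ρ * S i).trace = ε := by
    intro ε h
    rw [Matrix.trace_mul_comm, hρ, Matrix.mul_smul, Matrix.mul_vecMulVec, h, Matrix.trace_smul,
      Matrix.trace_vecMulVec, smul_dotProduct, ← hn, smul_eq_mul, smul_eq_mul]
    field_simp
  rw [expectation]
  rcases hvI i hi with h | h
  · rw [hS 1 (by simpa using h)]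
    simp
  · rw [hS (-1) (by simpa using h)]
    simp

end Expectation

/-! ### Odd cycles of anticommuting operators -/

section Skew

/-- If `K` is Hermitian and antisymmetric of odd order `n` and `r + K` is positive, then the
squared Frobenius norm of `K` is at most `(n - 1) r²`. -/
theorem sum_normSq_le_of_transpose_eq_neg {a : ℕ} {r : ℝ}
    {K : Matrix (Fin (2 * a + 1)) (Fin (2 * a + 1)) ℂ} (hK : K.IsHermitian) (hKt : Kᵀ = -K)
    (hpos : ((r : ℂ) • (1 : Matrix (Fin (2 * a + 1)) (Fin (2 * a + 1)) ℂ) + K).PosSemidef) :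
    ∑ j, ∑ k, ‖K j k‖ ^ 2 ≤ 2 * a * r ^ 2 := by
  -- Transposition turns `r + K` into `r - K`, so the spectrum lies in `[-r, r]`. Odd order forces
  -- `det K = 0`, and the resulting zero eigenvalue leaves `2a` terms in the sum of squares.
  have hpos' : ((r : ℂ) • (1 : Matrix (Fin (2 * a + 1)) (Fin (2 * a + 1)) ℂ) - K).PosSemidef := by
    have := hpos.transpose
    rwa [Matrix.transpose_add, hKt, Matrix.transpose_smul, Matrix.transpose_one,
      ← sub_eq_add_neg] at this
  have hdet : K.det = 0 := by
    have h : K.det = -K.det := by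
      conv_lhs => rw [← Matrix.det_transpose, hKt, Matrix.det_neg, Fintype.card_fin,
        Odd.neg_one_pow ⟨a, rfl⟩, neg_one_mul]
    exact self_eq_neg.1 h
  have hnorm : ∀ i, star (hK.eigenvectorBasis i : Fin (2 * a + 1) → ℂ) ⬝ᵥ
      (hK.eigenvectorBasis i : Fin (2 * a + 1) → ℂ) = 1 := by
    intro i
    have h := hK.eigenvectorBasis.orthonormal.1 i
    have h2 := EuclideanSpace.inner_eq_star_dotProduct (𝕜 := ℂ)
      (hK.eigenvectorBasis i) (hK.eigenvectorBasis i)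
    rw [inner_self_eq_norm_sq_to_K, h] at h2
    rw [dotProduct_comm, ← h2]
    simp
  have hbound : ∀ i, |hK.eigenvalues i| ≤ r := by
    intro i
    have h1 := hpos.dotProduct_mulVec_nonneg (hK.eigenvectorBasis i : Fin (2 * a + 1) → ℂ)
    have h2 := hpos'.dotProduct_mulVec_nonneg (hK.eigenvectorBasis i : Fin (2 * a + 1) → ℂ)
    rw [Matrix.add_mulVec, Matrix.smul_mulVec, Matrix.one_mulVec, hK.mulVec_eigenvectorBasis,
      dotProduct_add, dotProduct_smul, dotProduct_smul, hnorm] at h1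
    rw [Matrix.sub_mulVec, Matrix.smul_mulVec, Matrix.one_mulVec, hK.mulVec_eigenvectorBasis,
      dotProduct_sub, dotProduct_smul, dotProduct_smul, hnorm] at h2
    have h1' : (0 : ℝ) ≤ r + hK.eigenvalues i := by
      have : ((0 : ℝ) : ℂ) ≤ ((r + hK.eigenvalues i : ℝ) : ℂ) := by simpa using h1
      exact_mod_cast this
    have h2' : (0 : ℝ) ≤ r - hK.eigenvalues i := by
      have : ((0 : ℝ) : ℂ) ≤ ((r - hK.eigenvalues i : ℝ) : ℂ) := by simpa using h2
      exact_mod_cast this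
    exact abs_le.2 ⟨by linarith, by linarith⟩
  obtain ⟨i₀, hi₀⟩ : ∃ i, hK.eigenvalues i = 0 := by
    rw [hK.det_eq_prod_eigenvalues, Finset.prod_eq_zero_iff] at hdet
    obtain ⟨i, -, hi⟩ := hdet
    exact ⟨i, by simpa using hi⟩
  have htrace : (K * K).trace = ∑ i, (hK.eigenvalues i : ℂ) ^ 2 := by
    conv_lhs => rw [hK.spectral_theorem]
    rw [← map_mul, Unitary.conjStarAlgAut_apply, Matrix.trace_mul_comm, ← mul_assoc]
    simp [Matrix.trace_diagonal, sq]
  have hfrob : ((∑ j, ∑ k, ‖K j k‖ ^ 2 : ℝ) : ℂ) = (K * K).trace := by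
    push_cast
    simp only [Matrix.trace, Matrix.diag_apply, Matrix.mul_apply]
    refine Finset.sum_congr rfl fun j _ => Finset.sum_congr rfl fun k _ => ?_
    rw [← hK.apply k j, Complex.star_def, Complex.mul_conj, Complex.normSq_eq_norm_sq]
    push_cast
    rfl
  have hsum : ∑ j, ∑ k, ‖K j k‖ ^ 2 = ∑ i, hK.eigenvalues i ^ 2 := by
    rw [htrace] at hfrob
    exact_mod_cast hfrob
  rw [hsum, ← Finset.add_sum_erase _ _ (Finset.mem_univ i₀), hi₀]
  calc (0 : ℝ) ^ 2 + ∑ i ∈ Finset.univ.erase i₀, hK.eigenvalues i ^ 2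
      ≤ 0 ^ 2 + ∑ i ∈ Finset.univ.erase i₀, r ^ 2 := by
        gcongr 0 ^ 2 + ∑ i ∈ _, ?_ with i
        rw [← sq_abs (hK.eigenvalues i)]
        exact pow_le_pow_left₀ (abs_nonneg _) (hbound i) 2
    _ = 2 * a * r ^ 2 := by
        simp [Finset.card_erase_of_mem]

/-- The entries of a symmetric array along the cycle `0, 1, …, 2a` contribute at most half of the
total. -/
theorem two_mul_sum_cycle_le {a : ℕ} (ha : 1 ≤ a)
    (h : Fin (2 * a + 1) → Fin (2 * a + 1) → ℝ) (h0 : ∀ j k, 0 ≤ h j k)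
    (hsymm : ∀ j k, h j k = h k j) :
    2 * (∑ k : Fin (2 * a), h k.castSucc k.succ + h 0 (Fin.last (2 * a))) ≤
      ∑ j, ∑ k, h j k := by
  -- Each row then contains two distinct cycle entries, and by symmetry every cycle entry occurs
  -- twice in the array.
  have hne : ∀ j : Fin (2 * a + 1), j + 1 ≠ j - 1 := by
    intro j hj
    have h2 : (1 + 1 : Fin (2 * a + 1)) = 0 := by
      have : j + (1 + 1) = j + 0 := by rw [← add_assoc, hj]; simp
      exact add_left_cancel this
    have := congrArg Fin.val h2
    rw [Fin.val_add, Fin.val_one', Nat.mod_eq_of_lt (show 1 < 2 * a + 1 by omega),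
      Nat.mod_eq_of_lt (show 1 + 1 < 2 * a + 1 by omega)] at this
    simp at this
  have h1 : ∑ j, (h j (j + 1) + h j (j - 1)) ≤ ∑ j, ∑ k, h j k := by
    refine Finset.sum_le_sum fun j _ => ?_
    rw [← Finset.sum_pair (hne j)]
    exact Finset.sum_le_sum_of_subset_of_nonneg (Finset.subset_univ _) fun k _ _ => h0 j k
  have h2 : ∑ j, h j (j - 1) = ∑ j, h j (j + 1) := by
    rw [← Equiv.sum_comp (Equiv.addRight (1 : Fin (2 * a + 1)))]
    refine Finset.sum_congr rfl fun j _ => ?_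
    rw [Equiv.coe_addRight, add_sub_cancel_right, hsymm]
  have h3 : ∑ j, h j (j + 1) =
      ∑ k : Fin (2 * a), h k.castSucc k.succ + h 0 (Fin.last (2 * a)) := by
    rw [Fin.sum_univ_castSucc, Fin.last_add_one, hsymm]
    simp only [Fin.coeSucc_eq_succ]
  rw [Finset.sum_add_distrib, h2, h3] at h1
  linarith

end Skew

/-! ### Products along a path and their Gram matrix -/

section Path

variable {ι : Type*} [Fintype ι] [DecidableEq ι]

/-- The products `X 0 * X 1 * ⋯ * X (k - 1)`. -/
def pathProd (X : ℕ → Matrix ι ι ℂ) : ℕ → Matrix ι ι ℂ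
  | 0 => 1
  | k + 1 => pathProd X k * X k

theorem pathProd_conjTranspose_mul_self {X : ℕ → Matrix ι ι ℂ} {n : ℕ}
    (hX : ∀ k < n, (X k)ᴴ = -X k) (hXX : ∀ k < n, X k * X k = -1) :
    ∀ k ≤ n, (pathProd X k)ᴴ * pathProd X k = 1 := by
  intro k
  induction k with
  | zero => simp [pathProd]
  | succ k ih =>
    intro hk
    rw [pathProd, Matrix.conjTranspose_mul, mul_assoc, ← mul_assoc (pathProd X k)ᴴ,
      ih (by omega), one_mul, hX k (by omega), neg_mul, hXX k (by omega), neg_neg]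

/-- For operators `X 0, …, X (n-1)` which anticommute exactly with their neighbours, the path
products satisfy the Clifford relations. -/
theorem pathProd_conjTranspose_mul_eq_neg {X : ℕ → Matrix ι ι ℂ} {n : ℕ}
    (hX : ∀ k < n, (X k)ᴴ = -X k) (hXX : ∀ k < n, X k * X k = -1)
    (hanti : ∀ k, k + 1 < n → X (k + 1) * X k = -(X k * X (k + 1)))
    (hcomm : ∀ k l, l + 2 ≤ k → k < n → X k * X l = X l * X k) {j k : ℕ} (hjk : j < k)
    (hk : k ≤ n) :
    (pathProd X k)ᴴ * pathProd X j = -((pathProd X j)ᴴ * pathProd X k) := by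
  -- By unitarity `A k` is the segment `X j ⋯ X (k - 1)` for `j ≤ k ≤ n`. The next factor
  -- anticommutes with its last factor only, so by induction every nonempty segment is
  -- skew-Hermitian.
  obtain ⟨A, hA⟩ : ∃ A : ℕ → Matrix ι ι ℂ, A = fun k => (pathProd X j)ᴴ * pathProd X k :=
    ⟨_, rfl⟩
  have hAj : A j = 1 := by
    rw [hA]
    exact pathProd_conjTranspose_mul_self hX hXX j (by omega)
  have hAs : ∀ k, A (k + 1) = A k * X k := fun k => by simp only [hA, pathProd, mul_assoc]
  have hcommA : ∀ d l, j + d < l → l < n → X l * A (j + d) = A (j + d) * X l := by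
    intro d
    induction d with
    | zero => intro l _ _; simp [hAj]
    | succ d ih =>
      intro l hl hln
      rw [← add_assoc, hAs, ← mul_assoc, ih l (by omega) hln, mul_assoc, mul_assoc,
        hcomm l (j + d) (by omega) hln]
  have hantiA : ∀ d, j + d + 1 < n →
      X (j + d + 1) * A (j + d + 1) = -(A (j + d + 1) * X (j + d + 1)) := by
    intro d hd
    rw [hAs, ← mul_assoc, hcommA d _ (by omega) hd, mul_assoc, mul_assoc, hanti _ hd, mul_neg]
  have hmain : ∀ d, j + d + 1 ≤ n → (A (j + d + 1))ᴴ = -A (j + d + 1) := by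
    intro d
    induction d with
    | zero =>
      intro hd
      rw [add_zero, hAs, hAj, one_mul, hX j (by omega)]
    | succ d ih =>
      intro hd
      rw [← add_assoc, hAs, Matrix.conjTranspose_mul, ih (by omega), hX _ (by omega), neg_mul_neg,
        hantiA d (by omega)]
  have h := hmain (k - j - 1) (by omega)
  rw [show j + (k - j - 1) + 1 = k by omega] at h
  simpa [hA, Matrix.conjTranspose_mul] using h

/-- The Gram matrix bound for the path products. -/
theorem sum_path_normSq_le {X : ℕ → Matrix ι ι ℂ} {a : ℕ} (ha : 1 ≤ a)
    (hX : ∀ k < 2 * a, (X k)ᴴ = -X k) (hXX : ∀ k < 2 * a, X k * X k = -1)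
    (hanti : ∀ k, k + 1 < 2 * a → X (k + 1) * X k = -(X k * X (k + 1)))
    (hcomm : ∀ k l, l + 2 ≤ k → k < 2 * a → X k * X l = X l * X k)
    {ρ : Matrix ι ι ℂ} (hρ : ρ.PosSemidef) :
    ∑ k ∈ Finset.range (2 * a), ‖(ρ * X k).trace‖ ^ 2 + ‖(ρ * pathProd X (2 * a)).trace‖ ^ 2 ≤
      a * ρ.trace.re ^ 2 := by
  set B := pathProd X with hB
  set r : ℝ := ρ.trace.re with hr
  have hrt : ρ.trace = r := by
    have := trace_mul_eq_ofReal (A := 1) hρ.1 (by simp)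
    simpa using this
  -- This Gram matrix has diagonal `r` and antisymmetric off-diagonal part. Its entries along the
  -- cycle are the expectations of the `X k` and, in the corner, of the full path product.
  let Γ : Matrix (Fin (2 * a + 1)) (Fin (2 * a + 1)) ℂ :=
    Matrix.of fun j k => (ρ * ((B j)ᴴ * B k)).trace
  have hΓh : Γ.IsHermitian := by
    ext j k
    simp only [Γ, Matrix.conjTranspose_apply, Matrix.of_apply]
    rw [star_trace_mul hρ.1, Matrix.conjTranspose_mul, Matrix.conjTranspose_conjTranspose]
  have hΓ : Γ.PosSemidef := by
    refine Matrix.PosSemidef.of_dotProduct_mulVec_nonneg hΓh fun x => ?_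
    have h := trace_mul_conjTranspose_mul_self_nonneg hρ (∑ k : Fin (2 * a + 1), x k • B k)
    convert h using 1
    rw [Matrix.conjTranspose_sum, Finset.sum_mul_sum, Finset.mul_sum, Matrix.trace_sum]
    simp only [dotProduct, Matrix.mulVec, Finset.mul_sum, Matrix.trace_sum]
    refine Finset.sum_congr rfl fun j _ => Finset.sum_congr rfl fun k _ => ?_
    rw [Matrix.conjTranspose_smul, smul_mul_smul_comm, Matrix.mul_smul, Matrix.trace_smul]
    simp only [Γ, Matrix.of_apply, Pi.star_apply, smul_eq_mul]
    ring
  set K := Γ - (r : ℂ) • (1 : Matrix (Fin (2 * a + 1)) (Fin (2 * a + 1)) ℂ) with hK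
  have hΓdiag : ∀ j, Γ j j = r := by
    intro j
    simp only [Γ, Matrix.of_apply]
    rw [pathProd_conjTranspose_mul_self hX hXX j (by omega), mul_one, hrt]
  have hΓoff : ∀ j k, j ≠ k → Γ k j = -Γ j k := by
    have key : ∀ j k : Fin (2 * a + 1), j < k → Γ k j = -Γ j k := by
      intro j k hjk
      simp only [Γ, Matrix.of_apply]
      rw [pathProd_conjTranspose_mul_eq_neg hX hXX hanti hcomm (Fin.lt_def.1 hjk) (by omega),
        mul_neg, Matrix.trace_neg]
    intro j k hjk
    rcases lt_or_gt_of_ne hjk with h | h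
    · exact key j k h
    · rw [key k j h, neg_neg]
  have hKherm : K.IsHermitian := by
    refine hΓh.sub ?_
    rw [Matrix.IsHermitian, Matrix.conjTranspose_smul, Matrix.conjTranspose_one]
    simp
  have hKt : Kᵀ = -K := by
    ext j k
    by_cases hjk : j = k
    · subst hjk
      simp [hK, hΓdiag]
    · simp [hK, hΓoff j k hjk, Matrix.one_apply_ne hjk, Matrix.one_apply_ne (Ne.symm hjk)]
  have hKoff : ∀ j k, j ≠ k → K j k = Γ j k := by
    intro j k hjk
    simp [hK, Matrix.one_apply_ne hjk]
  have h1 := sum_normSq_le_of_transpose_eq_neg (r := r) hKherm hKt (by rw [hK]; simpa using hΓ)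
  have h2 := two_mul_sum_cycle_le ha (fun j k => ‖K j k‖ ^ 2) (fun _ _ => by positivity)
    (fun j k => by rw [← hKherm.apply j k, norm_star])
  have h3 : ∀ k : Fin (2 * a), K k.castSucc k.succ = (ρ * X k).trace := by
    intro k
    rw [hKoff _ _ (Fin.castSucc_lt_succ).ne]
    simp only [Γ, Matrix.of_apply, Fin.val_castSucc, Fin.val_succ, hB, pathProd]
    rw [← mul_assoc (pathProd X k)ᴴ, pathProd_conjTranspose_mul_self hX hXX k (by omega), one_mul]
  have h4 : K 0 (Fin.last (2 * a)) = (ρ * B (2 * a)).trace := by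
    rw [hKoff _ _ (by simp [Fin.ext_iff]; omega)]
    simp [Γ, hB, pathProd]
  simp only [h3, h4] at h2
  rw [Finset.sum_range]
  linarith

end Path

/-! ### The chordless odd cycle inequality -/

section Cycle

/-- `j` and `l` are neighbours on the cycle `0, 1, …, n`. -/
def CyclicAdj (n j l : ℕ) : Prop :=
  l = j + 1 ∨ j = l + 1 ∨ (j = 0 ∧ l = n) ∨ (j = n ∧ l = 0)

open Classical in
-- Each position has exactly two distinct neighbours, so the signs cancel. This makes the product of
-- all operators on the cycle commute with each of them.
theorem prod_cyclicAdj_sign {n j : ℕ} (hn : 2 ≤ n) (hj : j ≤ n) :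
    ∏ l ∈ Finset.range (n + 1), (if CyclicAdj n j l then (-1 : ℂ) else 1) = 1 := by
  obtain ⟨p, q, hp, hq, hpq, hiff⟩ : ∃ p q, p ≤ n ∧ q ≤ n ∧ p ≠ q ∧
      ∀ l ≤ n, CyclicAdj n j l ↔ l = p ∨ l = q := by
    unfold CyclicAdj
    rcases Nat.eq_zero_or_pos j with rfl | h0
    · exact ⟨1, n, by omega, le_rfl, by omega, fun l hl => by omega⟩
    · rcases hj.lt_or_eq with h | rfl
      · exact ⟨j + 1, j - 1, by omega, by omega, by omega, fun l hl => by omega⟩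
      · exact ⟨0, j - 1, by omega, by omega, by omega, fun l hl => by omega⟩
  have hsub : ({p, q} : Finset ℕ) ⊆ Finset.range (n + 1) := by
    intro l hl
    rw [Finset.mem_insert, Finset.mem_singleton] at hl
    rw [Finset.mem_range]
    omega
  rw [← Finset.prod_subset hsub, Finset.prod_pair hpq, if_pos ((hiff p hp).2 (.inl rfl)),
    if_pos ((hiff q hq).2 (.inr rfl))]
  · norm_num
  · intro l hl hlpq
    rw [Finset.mem_range] at hl
    rw [Finset.mem_insert, Finset.mem_singleton] at hlpq
    exact if_neg fun h => hlpq ((hiff l (by omega)).1 h)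

/-- Minkowski's inequality in squared form, used to add the contributions of the two eigenspaces of
`Z`. -/
theorem sum_add_sq_le {κ : Type*} (s : Finset κ) (p q : κ → ℝ) {a r t : ℝ} (ha : 0 ≤ a)
    (hr : 0 ≤ r) (ht : 0 ≤ t) (hp : ∑ k ∈ s, p k ^ 2 ≤ a * r ^ 2)
    (hq : ∑ k ∈ s, q k ^ 2 ≤ a * t ^ 2) : ∑ k ∈ s, (p k + q k) ^ 2 ≤ a * (r + t) ^ 2 := by
  have hpq : ∑ k ∈ s, p k * q k ≤ a * r * t := by
    refine le_of_sq_le_sq ?_ (by positivity)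
    calc (∑ k ∈ s, p k * q k) ^ 2 ≤ (∑ k ∈ s, p k ^ 2) * ∑ k ∈ s, q k ^ 2 :=
          Finset.sum_mul_sq_le_sq_mul_sq s p q
      _ ≤ (a * r ^ 2) * (a * t ^ 2) :=
          mul_le_mul hp hq (Finset.sum_nonneg fun _ _ => sq_nonneg _) (by positivity)
      _ = (a * r * t) ^ 2 := by ring
  have : ∑ k ∈ s, (p k + q k) ^ 2 =
      ∑ k ∈ s, p k ^ 2 + 2 * ∑ k ∈ s, p k * q k + ∑ k ∈ s, q k ^ 2 := by
    rw [Finset.mul_sum, ← Finset.sum_add_distrib, ← Finset.sum_add_distrib]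
    exact Finset.sum_congr rfl fun k _ => by ring
  rw [this]
  nlinarith

variable {ι : Type*} [Fintype ι] [DecidableEq ι]

open Classical in
/-- The odd cycle inequality for operators which anticommute exactly along a cycle. -/
theorem sum_cycle_normSq_le {X : ℕ → Matrix ι ι ℂ} {a : ℕ} (ha : 1 ≤ a)
    (hX : ∀ k ≤ 2 * a, (X k)ᴴ = -X k) (hXX : ∀ k ≤ 2 * a, X k * X k = -1)
    (hrel : ∀ j ≤ 2 * a, ∀ l ≤ 2 * a,
      X j * X l = (if CyclicAdj (2 * a) j l then (-1 : ℂ) else 1) • (X l * X j))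
    {ρ : Matrix ι ι ℂ} (hρ : ρ.PosSemidef) :
    ∑ k ∈ Finset.range (2 * a + 1), ‖(ρ * X k).trace‖ ^ 2 ≤ a * ρ.trace.re ^ 2 := by
  have hanti : ∀ k, k + 1 < 2 * a → X (k + 1) * X k = -(X k * X (k + 1)) := by
    intro k hk
    rw [hrel (k + 1) (by omega) k (by omega), if_pos (by simp [CyclicAdj]), neg_smul, one_smul]
  have hcomm : ∀ k l, l + 2 ≤ k → k < 2 * a → X k * X l = X l * X k := by
    intro k l hl hk
    rw [hrel k (by omega) l (by omega), if_neg (by unfold CyclicAdj; omega), one_smul]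
  have hX' : ∀ k < 2 * a, (X k)ᴴ = -X k := fun k hk => hX k hk.le
  have hXX' : ∀ k < 2 * a, X k * X k = -1 := fun k hk => hXX k hk.le
  have hsign : ∀ j ≤ 2 * a, ∀ k ≤ 2 * a + 1, X j * pathProd X k =
      (∏ l ∈ Finset.range k, (if CyclicAdj (2 * a) j l then (-1 : ℂ) else 1)) •
        (pathProd X k * X j) := by
    intro j hj k
    induction k with
    | zero => simp [pathProd]
    | succ k ih =>
      intro hk
      rw [pathProd, ← mul_assoc, ih (by omega), Finset.prod_range_succ, smul_mul_assoc, mul_assoc,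
        hrel j hj k (by omega), mul_smul_comm, smul_smul, mul_assoc]
  obtain ⟨B, hB⟩ : ∃ B, B = pathProd X (2 * a) := ⟨_, rfl⟩
  -- `Z` is a Hermitian involution commuting with every `X j`, and `X (2 * a) = -(B * Z)`. On an
  -- eigenspace of `Z` the last operator is therefore `B` up to sign.
  obtain ⟨Z, hZ⟩ : ∃ Z, Z = pathProd X (2 * a + 1) := ⟨_, rfl⟩
  have hZB : Z = B * X (2 * a) := by rw [hZ, hB, pathProd]
  have hZX : ∀ j ≤ 2 * a, X j * Z = Z * X j := by
    intro j hj
    rw [hZ, hsign j hj _ le_rfl, prod_cyclicAdj_sign (by omega) hj, one_smul]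
  have hXB : X (2 * a) * B = B * X (2 * a) := by
    have h := prod_cyclicAdj_sign (n := 2 * a) (j := 2 * a) (by omega) le_rfl
    rw [Finset.prod_range_succ, if_neg (by unfold CyclicAdj; omega), mul_one] at h
    rw [hB, hsign _ le_rfl _ (by omega), h, one_smul]
  have hBh : Bᴴ = -B := by
    have := pathProd_conjTranspose_mul_eq_neg hX' hXX' hanti hcomm
      (show 0 < 2 * a by omega) le_rfl
    simpa [hB, pathProd] using this
  have hBB : B * B = -1 := by
    have := pathProd_conjTranspose_mul_self hX' hXX' (2 * a) le_rfl
    rw [← hB, hBh, neg_mul] at this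
    rw [← this, neg_neg]
  have hZh : Zᴴ = Z := by
    rw [hZB, Matrix.conjTranspose_mul, hBh, hX _ le_rfl, neg_mul_neg, hXB]
  have hZZ : Z * Z = 1 := by
    nth_rw 2 [hZB]
    rw [← mul_assoc, hZB, mul_assoc B, hXB, ← mul_assoc B, hBB, mul_assoc, hXX _ le_rfl]
    simp
  have hXlast : X (2 * a) = -(B * Z) := by
    rw [hZB, ← mul_assoc, hBB]
    simp
  -- Compression to the `σ`-eigenspace of `Z`. The compressed state is not normalized, which is why
  -- the path bound carries the factor `ρ.trace.re ^ 2`.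
  have hsector : ∀ σ : ℂ, (σ = 1 ∨ σ = -1) →
      ∀ P : Matrix ι ι ℂ, P = (1 / 2 : ℂ) • (1 + σ • Z) →
      (P * ρ * P).PosSemidef ∧ (∀ k ≤ 2 * a, (P * ρ * P * X k).trace = (ρ * X k * P).trace) ∧
      (P * ρ * P).trace = (ρ * P).trace ∧
      ∑ k ∈ Finset.range (2 * a + 1), ‖(P * ρ * P * X k).trace‖ ^ 2 ≤
        a * (P * ρ * P).trace.re ^ 2 := by
    intro σ hσ P hP
    have hσσ : σ * σ = 1 := by rcases hσ with rfl | rfl <;> norm_num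
    have hσs : star σ = σ := by rcases hσ with rfl | rfl <;> simp
    have hσn : ‖σ‖ = 1 := by rcases hσ with rfl | rfl <;> simp
    have hPh : Pᴴ = P := by
      rw [hP, Matrix.conjTranspose_smul, Matrix.conjTranspose_add, Matrix.conjTranspose_smul,
        hZh, hσs, Matrix.conjTranspose_one]
      simp
    have hZP : Z * P = σ • P := by
      rw [hP, mul_smul_comm, mul_add, mul_one, mul_smul_comm, hZZ, smul_comm σ, smul_add σ,
        smul_smul σ σ, hσσ, one_smul, add_comm]
    have hPP : P * P = P := by
      nth_rw 1 [hP]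
      rw [smul_mul_assoc, add_mul, one_mul, smul_mul_assoc, hZP, smul_smul, hσσ, one_smul,
        ← two_smul ℂ P, smul_smul]
      norm_num
    have hpos : (P * ρ * P).PosSemidef := by
      have := hρ.mul_mul_conjTranspose_same P
      rwa [hPh] at this
    have htr : ∀ k ≤ 2 * a, (P * ρ * P * X k).trace = (ρ * X k * P).trace := by
      intro k hk
      have hcommP : P * X k = X k * P := by
        rw [hP, smul_mul_assoc, add_mul, smul_mul_assoc, mul_smul_comm, mul_add, mul_smul_comm,
          hZX k hk, one_mul, mul_one]
      rw [mul_assoc, mul_assoc, Matrix.trace_mul_comm, hcommP, mul_assoc, mul_assoc, hPP,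
        ← mul_assoc]
    refine ⟨hpos, htr, ?_, ?_⟩
    · rw [Matrix.trace_mul_comm, ← mul_assoc, hPP, Matrix.trace_mul_comm]
    · have h := sum_path_normSq_le ha hX' hXX' hanti hcomm hpos
      rw [← hB] at h
      have hlast : ‖(P * ρ * P * X (2 * a)).trace‖ = ‖(P * ρ * P * B).trace‖ := by
        rw [hXlast, mul_neg, Matrix.trace_neg, norm_neg, ← mul_assoc, Matrix.trace_mul_comm,
          ← mul_assoc, ← mul_assoc, ← mul_assoc, hZP, smul_mul_assoc, smul_mul_assoc,
          smul_mul_assoc, Matrix.trace_smul, norm_smul, hσn, one_mul]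
      rw [Finset.sum_range_succ, hlast]
      exact h
  obtain ⟨hp1, hp2, hp3, hp4⟩ := hsector 1 (.inl rfl) _ rfl
  obtain ⟨hm1, hm2, hm3, hm4⟩ := hsector (-1) (.inr rfl) _ rfl
  generalize hPp : (1 / 2 : ℂ) • (1 + (1 : ℂ) • Z) = P at hp1 hp2 hp3 hp4
  generalize hPm : (1 / 2 : ℂ) • (1 + (-1 : ℂ) • Z) = Q at hm1 hm2 hm3 hm4
  have hPQ : P + Q = 1 := by
    rw [← hPp, ← hPm]
    module
  have hsplit : ∀ A : Matrix ι ι ℂ, A.trace = (A * P).trace + (A * Q).trace := by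
    intro A
    rw [← Matrix.trace_add, ← mul_add, hPQ, mul_one]
  have hr : ρ.trace.re = (P * ρ * P).trace.re + (Q * ρ * Q).trace.re := by
    rw [hsplit ρ, hp3, hm3, Complex.add_re]
  rw [hr]
  refine le_trans (Finset.sum_le_sum fun k hk => ?_)
    (sum_add_sq_le _ _ _ (Nat.cast_nonneg a) (Complex.le_def.1 hp1.trace_nonneg).1
      (Complex.le_def.1 hm1.trace_nonneg).1 hp4 hm4)
  have hk' : k ≤ 2 * a := by
    have := Finset.mem_range.1 hk
    omega
  rw [hsplit (ρ * X k), ← hp2 k hk', ← hm2 k hk']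
  exact pow_le_pow_left₀ (norm_nonneg _) (norm_add_le _ _) 2

/-- The squared expectations of self-adjoint unitaries which anticommute exactly along a cycle
of length `2a+1` add up to at most `a`. -/
theorem sum_cycle_sq_expectation_le {S : ℕ → Matrix ι ι ℂ} {a : ℕ} (ha : 1 ≤ a)
    (hS : ∀ k ≤ 2 * a, (S k)ᴴ = S k) (hSS : ∀ k ≤ 2 * a, S k * S k = 1)
    (hanti : ∀ j ≤ 2 * a, ∀ l ≤ 2 * a, CyclicAdj (2 * a) j l → S j * S l = -(S l * S j))
    (hcomm : ∀ j ≤ 2 * a, ∀ l ≤ 2 * a, ¬CyclicAdj (2 * a) j l → S j * S l = S l * S j)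
    {ρ : Matrix ι ι ℂ} (hρ : IsState ρ) :
    ∑ k ∈ Finset.range (2 * a + 1), expectation (S k) ρ ^ 2 ≤ a := by
  -- The factor `I` makes the operators skew-Hermitian with square `-1`, leaving commutation signs
  -- and moduli of traces unchanged.
  have h := sum_cycle_normSq_le (X := fun k => Complex.I • S k) ha
    (fun k hk => by
      rw [Matrix.conjTranspose_smul, hS k hk, Complex.star_def, Complex.conj_I, neg_smul])
    (fun k hk => by
      rw [smul_mul_smul_comm, hSS k hk, Complex.I_mul_I, neg_smul, one_smul])
    (fun j hj l hl => by
      rw [smul_mul_smul_comm, smul_mul_smul_comm, Complex.I_mul_I]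
      split_ifs with hjl
      · rw [hanti j hj l hl hjl]
        module
      · rw [hcomm j hj l hl hjl, one_smul]) hρ.1
  rw [hρ.2] at h
  simp only [Complex.one_re, one_pow, mul_one] at h
  refine le_trans (Finset.sum_le_sum fun k hk => ?_) h
  rw [Matrix.mul_smul, Matrix.trace_smul, norm_smul, Complex.norm_I, one_mul, expectation, ← sq_abs]
  exact pow_le_pow_left₀ (abs_nonneg _) (Complex.abs_re_le_norm _) 2

end Cycle

/-! ### Reduction of odd closed walks to chordless odd cycles -/

section Chords

variable {V : Type*}

theorem sum_range_periodic {p : ℕ → ℝ} {n : ℕ} (hp : ∀ k, p (k + n) = p k) (s : ℕ) :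
    ∑ k ∈ Finset.range n, p (s + k) = ∑ k ∈ Finset.range n, p k := by
  induction s with
  | zero => simp
  | succ s ih =>
    rw [← ih]
    have h1 := Finset.sum_range_succ (fun k => p (s + k)) n
    have h2 := Finset.sum_range_succ' (fun k => p (s + k)) n
    rw [hp s] at h1
    simp only [add_zero] at h2
    simp only [add_assoc, add_comm 1]
    linarith

theorem sum_pairs_le {x : V → ℝ} {h : ℕ → V} (b : ℕ) :
    ∀ n, (∀ k, b ≤ k → k + 1 < b + 2 * n → x (h k) + x (h (k + 1)) ≤ 1) →
      ∑ k ∈ Finset.range (2 * n), x (h (b + k)) ≤ n := by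
  intro n
  induction n with
  | zero => simp
  | succ n ih =>
    intro hk
    rw [show 2 * (n + 1) = 2 * n + 1 + 1 by ring, Finset.sum_range_succ, Finset.sum_range_succ]
    have h1 := ih fun k hb hk' => hk k hb (by omega)
    have h2 := hk (b + 2 * n) (by omega) (by omega)
    push_cast
    rw [← add_assoc b]
    linarith

/-- The inequality of an odd closed walk follows from the edge inequalities and the inequalities
of the chordless odd cycles. -/
theorem sum_oddClosedWalk_le {G : SimpleGraph V} {x : V → ℝ}
    (hedge : ∀ i j, G.Adj i j → x i + x j ≤ 1)
    (hind : ∀ (a : ℕ) (g : ℕ → V), 1 ≤ a →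
      (∀ j ≤ 2 * a, ∀ l ≤ 2 * a, G.Adj (g j) (g l) ↔ CyclicAdj (2 * a) j l) →
      ∑ k ∈ Finset.range (2 * a + 1), x (g k) ≤ a)
    (a : ℕ) : ∀ g, IsOddClosedWalk G a g → ∑ k ∈ Finset.range (2 * a + 1), x (g k) ≤ a := by
  induction a using Nat.strong_induction_on with
  | _ a ih =>
  intro g hg
  have ha : 1 ≤ a := by
    by_contra h
    obtain rfl : a = 0 := by omega
    exact G.irrefl hg.2
  by_cases hchord : ∀ j ≤ 2 * a, ∀ l ≤ 2 * a, G.Adj (g j) (g l) ↔ CyclicAdj (2 * a) j l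
  · exact hind a g ha hchord
  have hcyc : ∀ j ≤ 2 * a, ∀ l ≤ 2 * a, CyclicAdj (2 * a) j l → G.Adj (g j) (g l) := by
    rintro j hj l hl (rfl | rfl | ⟨rfl, rfl⟩ | ⟨rfl, rfl⟩)
    · exact hg.1 j (by omega)
    · exact (hg.1 l (by omega)).symm
    · exact hg.2.symm
    · exact hg.2
  obtain ⟨j, l, hjl, hl, hadj, hnot⟩ : ∃ j l, j < l ∧ l ≤ 2 * a ∧ G.Adj (g j) (g l) ∧
      ¬CyclicAdj (2 * a) j l := by
    by_contra! hcon
    apply hchord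
    intro j hj l hl
    refine ⟨fun hadj => ?_, hcyc j hj l hl⟩
    rcases lt_trichotomy j l with h | rfl | h
    · exact hcon j l h hl hadj
    · exact absurd hadj (G.irrefl)
    · have := hcon l j h hj hadj.symm
      unfold CyclicAdj at this ⊢
      omega
  set n := 2 * a + 1 with hn
  let p : ℕ → V := fun k => g (k % n)
  have hp : ∀ k, p (k + n) = p k := fun k => by simp [p]
  have hpg : ∀ k < n, p k = g k := fun k hk => by simp [p, Nat.mod_eq_of_lt hk]
  have hpadj : ∀ k, G.Adj (p k) (p (k + 1)) := by
    intro k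
    have hlt : k % n < n := Nat.mod_lt _ (by omega)
    simp only [p]
    rcases Nat.lt_or_ge (k % n + 1) n with h | h
    · rw [Nat.add_mod, Nat.mod_eq_of_lt (show 1 < n by omega), Nat.mod_eq_of_lt h]
      exact hg.1 _ (by omega)
    · have hk : k % n = 2 * a := by omega
      rw [Nat.add_mod, Nat.mod_eq_of_lt (show 1 < n by omega), hk, ← hn, Nat.mod_self]
      exact hg.2
  -- The two arcs cut off by the chord have different parity. The arc with an even number of edges
  -- closes with the chord to a shorter odd walk; the remaining `2 * (a - d)` vertices pair up along
  -- edges.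
  obtain ⟨s, d, hd, hda, hsd⟩ : ∃ s d, 1 ≤ d ∧ d < a ∧ G.Adj (p (s + 2 * d)) (p s) := by
    unfold CyclicAdj at hnot
    rcases Nat.even_or_odd' (l - j) with ⟨d, hd | hd⟩
    · refine ⟨j, d, by omega, by omega, ?_⟩
      rw [← hd, show j + (l - j) = l by omega, hpg l (by omega), hpg j (by omega)]
      exact hadj.symm
    · refine ⟨l, a - d, by omega, by omega, ?_⟩
      rw [show l + 2 * (a - d) = j + n by omega, hp, hpg l (by omega), hpg j (by omega)]
      exact hadj
  have hsum : ∑ k ∈ Finset.range n, x (g k) = ∑ k ∈ Finset.range n, x (p (s + k)) := by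
    rw [sum_range_periodic (p := fun k => x (p k)) (fun k => by simp only [hp])]
    exact Finset.sum_congr rfl fun k hk => by rw [hpg k (Finset.mem_range.1 hk)]
  rw [hsum, show n = (2 * d + 1) + 2 * (a - d) by omega, Finset.sum_range_add]
  have h1 := ih d hda (fun k => p (s + k)) ⟨fun k _ => hpadj (s + k), hsd⟩
  have h2 := sum_pairs_le (x := x) (h := fun k => p (s + k)) (2 * d + 1) (a - d)
    fun k _ _ => hedge _ _ (hpadj (s + k))
  rw [Nat.cast_sub hda.le] at h2
  linarith

end Chords

/-! ### `h`-perfect graphs are `ħ`-perfect -/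

section Hbar

variable {V : Type*} {G : SimpleGraph V} {m : ℕ} {S : V → Fin m → PauliLabel}

theorem IsRealization.commute (hS : IsRealization G S) {i j : V} (hij : ¬G.Adj i j) :
    pauliString (S i) * pauliString (S j) = pauliString (S j) * pauliString (S i) :=
  (pauliString_commute_or_anticommute (S i) (S j)).resolve_right fun h => hij ((hS i j).2 h)

theorem IsRealization.sum_clique_le (hS : IsRealization G S) {K : Finset V}
    (hK : G.IsClique (K : Set V)) {ρ} (hρ : IsState ρ) :
    ∑ i ∈ K, expectation (pauliString (S i)) ρ ^ 2 ≤ 1 :=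
  sum_sq_expectation_le_one K _ (fun _ _ => pauliString_conjTranspose _)
    (fun _ _ => pauliString_mul_self _) (fun i hi j hj hij => (hS i j).1 (hK hi hj hij)) hρ

theorem IsRealization.sum_oddClosedWalk_le (hS : IsRealization G S) {a : ℕ} {g : ℕ → V}
    (hg : IsOddClosedWalk G a g) {ρ} (hρ : IsState ρ) :
    ∑ k ∈ Finset.range (2 * a + 1), expectation (pauliString (S (g k))) ρ ^ 2 ≤ a := by
  classical
  refine HbarGraph.sum_oddClosedWalk_le (G := G)
    (x := fun i => expectation (pauliString (S i)) ρ ^ 2) (fun i j hij => ?_)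
    (fun a g ha hg => ?_) a g hg
  · have hcl : G.IsClique (({i, j} : Finset V) : Set V) := by
      rw [Finset.coe_pair, SimpleGraph.isClique_pair]
      exact fun _ => hij
    simpa [Finset.sum_pair hij.ne] using hS.sum_clique_le hcl hρ
  · exact sum_cycle_sq_expectation_le (S := fun k => pauliString (S (g k))) ha
      (fun _ _ => pauliString_conjTranspose _) (fun _ _ => pauliString_mul_self _)
      (fun j hj l hl h => (hS _ _).1 ((hg j hj l hl).2 h))
      (fun j hj l hl h => hS.commute fun h' => h ((hg j hj l hl).1 h')) hρ

theorem IsRealization.exists_isState (hS : IsRealization G S) {I : Finset V}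
    (hI : G.IsIndepSet (I : Set V)) :
    ∃ ρ, IsState ρ ∧ ∀ i ∈ I, expectation (pauliString (S i)) ρ ^ 2 = 1 := by
  refine exists_isState_sq_expectation_eq_one I _ (fun _ _ => pauliString_mul_self _) ?_
  intro i hi j hj
  by_cases hij : i = j
  · rw [hij]
  · exact hS.commute (hI hi hj hij)

/-- A joint eigenstate of the strings of an independent set has squared expectation `1` there.
Nothing is controlled elsewhere, so the vertex is reached only through the down-closure. -/
theorem IsRealization.stab_subset_betaBody [Fintype V] (hS : IsRealization G S) :
    stab G ⊆ betaBody S := by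
  classical
  refine fun x hx => ⟨convexHull_mono (fun v hv => ?_) hx, nonneg_of_mem_stab hx⟩
  obtain ⟨ρ, hρ, h1⟩ := hS.exists_isState (I := Finset.univ.filter fun i => v i = 1) (by
    intro i hi j hj _ hij
    simp only [Finset.coe_filter, Finset.mem_univ, true_and, Set.mem_ofPred_eq] at hi hj
    have := hv.1 i j hij
    simp [hi, hj] at this)
  rw [SetLike.mem_coe, mem_lowerClosure]
  refine ⟨_, ⟨ρ, hρ, rfl⟩, fun i => ?_⟩
  rcases hv.2 i with h | h
  · rw [h]
    positivity
  · rw [h1 i (by simp [h]), h]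

theorem IsHPerfect.varianceRange_subset_stab [Fintype V] (hG : IsHPerfect G)
    (hS : IsRealization G S) : varianceRange S ⊆ stab G := by
  rintro _ ⟨ρ, hρ, rfl⟩
  exact hG.mem_stab (fun i => sq_nonneg _) (fun K hK => hS.sum_clique_le hK hρ)
    fun a g hg => hS.sum_oddClosedWalk_le hg hρ

/-- Clique and odd walk functionals are monotone, so their bounds pass from the variance range to
its down-closure and then to the convex hull. -/
theorem IsHPerfect.betaBody_subset_stab [Fintype V] (hG : IsHPerfect G)
    (hS : IsRealization G S) : betaBody S ⊆ stab G := by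
  rintro x ⟨hx, hx0⟩
  have key : ∀ l : (V → ℝ) →ₗ[ℝ] ℝ, (∀ u v : V → ℝ, u ≤ v → l u ≤ l v) → ∀ c : ℝ,
      (∀ v ∈ varianceRange S, l v ≤ c) → l x ≤ c := by
    intro l hl c hc
    have hsub : convexHull ℝ (lowerClosure (varianceRange S) : Set (V → ℝ)) ⊆ {x | l x ≤ c} := by
      refine convexHull_min (fun u hu => ?_) (convex_halfSpace_le l.isLinear _)
      obtain ⟨v, hv, huv⟩ := mem_lowerClosure.1 hu
      exact (hl u v huv).trans (hc v hv)
    exact hsub hx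
  refine hG.mem_stab hx0 (fun K hK => ?_) fun a g hg => ?_
  · have := key (coordSum K).toLinearMap (fun u v huv => by
      simpa using Finset.sum_le_sum fun i _ => huv i) 1 (by
      rintro _ ⟨ρ, hρ, rfl⟩
      simpa using hS.sum_clique_le hK hρ)
    simpa using this
  · have := key (∑ k ∈ Finset.range (2 * a + 1), LinearMap.proj (g k)) (fun u v huv => by
      simpa using Finset.sum_le_sum fun k _ => huv (g k)) a (by
      rintro _ ⟨ρ, hρ, rfl⟩
      simpa using hS.sum_oddClosedWalk_le hg hρ)
    simpa using this

theorem bddAbove_indepNumber [Fintype V] (G : SimpleGraph V) (w : V → ℝ) :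
    BddAbove {r | ∃ s : Finset V, G.IsIndepSet (s : Set V) ∧ r = ∑ i ∈ s, w i} := by
  refine (Set.Finite.subset (Set.finite_range fun s : Finset V => ∑ i ∈ s, w i) ?_).bddAbove
  rintro _ ⟨s, -, rfl⟩
  exact ⟨s, rfl⟩

theorem sum_mul_le_indepNumber [Fintype V] {w x : V → ℝ} (hx : x ∈ stab G) :
    ∑ i, w i * x i ≤ indepNumber G w := by
  classical
  have := le_of_mem_stab (∑ i, w i • LinearMap.proj i) (c := indepNumber G w)
    (fun v hv h01 => ?_) hx
  · simpa using this
  · refine le_csSup (bddAbove_indepNumber G w) ⟨Finset.univ.filter fun i => v i = 1, ?_, ?_⟩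
    · intro i hi j hj _ hij
      simp only [Finset.coe_filter, Finset.mem_univ, true_and, Set.mem_ofPred_eq] at hi hj
      have := hv i j hij
      simp [hi, hj] at this
    · rw [Finset.sum_filter]
      simp only [LinearMap.sum_apply, LinearMap.smul_apply, LinearMap.proj_apply, smul_eq_mul]
      refine Finset.sum_congr rfl fun i _ => ?_
      rcases h01 i with h | h <;> simp [h]

theorem IsHPerfect.isHbarPerfect [Fintype V] (hG : IsHPerfect G) : IsHbarPerfect G := by
  intro m S hS
  refine ⟨hS.stab_subset_betaBody.antisymm (hG.betaBody_subset_stab hS), fun w hw => ?_⟩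
  -- Besides giving one inequality, this bounds the set above, without which its `sSup` would be a
  -- default value.
  have hle : ∀ r ∈ {r | ∃ ρ, IsState ρ ∧ r = ∑ i, w i * expectation (pauliString (S i)) ρ ^ 2},
      r ≤ indepNumber G w := by
    rintro _ ⟨ρ, hρ, rfl⟩
    exact sum_mul_le_indepNumber (hG.varianceRange_subset_stab hS ⟨ρ, hρ, rfl⟩)
  apply le_antisymm
  · refine csSup_le ?_ hle
    obtain ⟨ρ, hρ, -⟩ := hS.exists_isState (I := ∅) (by simp)
    exact ⟨_, ρ, hρ, rfl⟩
  · refine csSup_le ⟨_, ∅, by simp, rfl⟩ ?_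
    rintro _ ⟨s, hs, rfl⟩
    obtain ⟨ρ, hρ, h1⟩ := hS.exists_isState hs
    calc ∑ i ∈ s, w i = ∑ i ∈ s, w i * expectation (pauliString (S i)) ρ ^ 2 :=
          Finset.sum_congr rfl fun i hi => by rw [h1 i hi, mul_one]
      _ ≤ ∑ i, w i * expectation (pauliString (S i)) ρ ^ 2 :=
          Finset.sum_le_sum_of_subset_of_nonneg (Finset.subset_univ s)
            fun i _ _ => mul_nonneg (hw i) (sq_nonneg _)
      _ ≤ betaNumber S w := le_csSup ⟨_, hle⟩ ⟨ρ, hρ, rfl⟩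

end Hbar

end HbarGraph

theorem theorem2 {V : Type*} [Fintype V] (G : SimpleGraph V) :
    (HbarGraph.IsPerfect G → HbarGraph.IsHPerfect G) ∧
    (HbarGraph.IsHPerfect G → HbarGraph.IsHbarPerfect G) ∧
    (∀ a : ℕ, 1 ≤ a → HbarGraph.IsHPerfect (SimpleGraph.cycleGraph (2 * a + 1))) :=
  ⟨HbarGraph.IsPerfect.isHPerfect, HbarGraph.IsHPerfect.isHbarPerfect,
    fun _ => HbarGraph.isHPerfect_cycleGraph⟩
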